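/- **Setting.** Let $\Omega\subseteq\mathbb R^d$ be a Borel set, $\lambda>0$, and let $\phi:\Omega\to\mathbb R^n$ be continuous and vanishing at infinity on $\Omega$ (automatic if $\Omega$ is compact). For a finite signed Borel (Radon) measure $m$ on $\Omega$ put $\Phi m=\int_\Omega\phi\,dm$, and let $|m|_{TV}=|m|(\Omega)$. For $y\in\mathbb R^n$ the Blasso problem is $$(\mathcal P_\lambda(y))\qquad \min_m\ \tfrac12\|\Phi m-y\|_2^2+\lambda|m|_{TV}.$$ Write $(\Phi^*p)(x)=\langle\phi(x),p\rangle$; let $p_y$ be the minimizer of $\|p-y/\lambda\|_2$ subject to $\sup_\Omega|\Phi^*p|\le1$, $\eta_y=\Phi^*p_y$ the dual certificate, and $\mathcal E_y=\{x\in\Omega:|\eta_y(x)|=1\}$ the extended support. Let $\hat\mu(y)=\Phi m$ for any solution $m$ of $\mathcal P_\lambda(y)$ (the value does not depend on $m$). For $\beta\in\mathbb R^k$ and $X=(x_j)\in\Omega^k$ write $m_{\beta,X}=\sum_j\beta_j\delta_{x_j}$ and $\Phi_X=[\phi(x_1),\dots,\phi(x_k)]\in\mathbb R^{n\times k}$,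 and $\partial|m|_{TV}=\{f\in C(\Omega):\int f\,dm=|m|_{TV},\ \|f\|_\infty\le1\}$. Let $M^\dagger$ be the Moore–Penrose pseudoinverse, $M_S$ the columns of $M$ in $S$, and $M^\dagger_{(S^c,\cdot)}$ the rows of $M^\dagger$ in $S^c$. For $k\ge1$, $\sigma\in\{-1,1\}^k$, $I\subseteq S\subseteq[k]$ let $\mathcal Q_{k,S,\sigma,I}$ be the set of $(y,a,E)\in\mathbb R^n\times\mathbb R^k\times\Omega^k$ such that $E$ consists of $k$ pairwise distinct points of $\mathcal E_y$, $\Phi^*(y-\Phi_Ea)\in\lambda\,\partial|m_{a,E}|_{TV}$, the matrix $M=\Phi_E$ has rank $|S|$, and $$\Big(\big(M^\dagger+M_S^\dagger M_{S^c}M^\dagger_{(S^c,\cdot)}\big)\big(y-(M^*)^\dagger\lambda\sigma\big)\Big)_i=0\quad\text{for all } i\in I,$$ where for the rows in $S$ one uses the rows of the first $M^\dagger$ in $S$. Let $\mathcal H=\bigcup_{k,\sigma,S,I}\mathrm{Bd}\big(\Pi_Y(\mathcal Q_{k,S,\sigma,I})\big)$, where $\Pi_Y(y,a,E)=y$ and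 $\mathrm{Bd}$ is the topological boundary in $\mathbb R^n$. **Theorem.** Let $y\in\mathbb R^n$. Assume that every $x\in\mathcal E_y$ is an interior point of $\Omega$ near which $\phi$ is $C^2$; that (A1) holds: $\mathcal E_y$ is finite and $\eta_y(x)\nabla^2\eta_y(x)\prec0$ for all $x\in\mathcal E_y$; and that $y\notin\mathcal H$. There exist $k\ge0$, a $k$-tuple $A$ of distinct points of $\mathcal E_y$ with $\Phi_A$ injective, and $\beta\in\mathbb R^k$ with all entries nonzero, such that $m_{\beta,A}$ solves $\mathcal P_\lambda(y)$. For every such $(k,\beta,A)$, writing $\beta_y=\beta$ and $A_y=A=(x_j)_{j=1}^k$, the following hold. 1. There are an open neighbourhood $U$ of $y$ and a $C^1$ map $y'\in U\mapsto(\beta_{y'},A_{y'})\in\mathbb R^k\times\Omega^k$, with the given value $(\beta,A)$ at $y$, such that for every $y'\in U$ the measure $m_{\beta_{y'},A_{y'}}$ solves $\mathcal P_\lambda(y')$, the entries of $\beta_{y'}$ are nonzero and the points of $A_{y'}$ are distinct. 2. The divergence formula holds at $y$: with $\Gamma_A=[\Phi_A,\Phi_A^{(1)}]\in\mathbb R^{n\times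 k(d+1)}$, where $\Phi_A^{(1)}$ has the columns $\partial_l\phi(x_j)$, and $Q_j=-\frac{\lambda}{\beta_j}\nabla^2\eta_y(x_j)$, the matrix $M=\Gamma_A^*\Gamma_A+\mathrm{diag}(0_{k\times k},Q_1,\dots,Q_k)$ is invertible, $\hat\mu$ is differentiable at $y$, and $\mathrm{div}(\hat\mu)(y)=\mathrm{tr}(\Gamma_AM^{-1}\Gamma_A^*)$. -/

import Mathlib

open Set Filter Topology MeasureTheory
open scoped Matrix

noncomputable section

namespace Blasso

/-! ### Moore–Penrose pseudoinverse of a real matrix -/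

/-- `A` satisfies the four Penrose equations for `M`. -/
def IsPseudoinverse {ι κ : Type*} [Fintype ι] [Fintype κ]
    (M : Matrix ι κ ℝ) (A : Matrix κ ι ℝ) : Prop :=
  M * A * M = M ∧ A * M * A = A ∧ (M * A)ᵀ = M * A ∧ (A * M)ᵀ = A * M

theorem exists_isPseudoinverse {ι κ : Type*} [Fintype ι] [Fintype κ]
    (M : Matrix ι κ ℝ) : ∃ A : Matrix κ ι ℝ, IsPseudoinverse M A := by
  classical
  have hH : (Mᵀ * M).IsHermitian := by
    have := Matrix.isHermitian_conjTranspose_mul_self M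
    simpa [Matrix.conjTranspose_eq_transpose_of_trivial] using this
  obtain ⟨U, D, hU, hUH⟩ : ∃ (U : Matrix κ κ ℝ) (D : κ → ℝ), Uᵀ * U = 1 ∧
      Mᵀ * M = U * Matrix.diagonal D * Uᵀ := by
    refine ⟨hH.eigenvectorUnitary, hH.eigenvalues, ?_, ?_⟩
    · have := Unitary.coe_star_mul_self hH.eigenvectorUnitary
      rwa [Matrix.star_eq_conjTranspose,
        Matrix.conjTranspose_eq_transpose_of_trivial] at this
    · have := hH.spectral_theorem
      rw [Unitary.conjStarAlgAut_apply, Matrix.star_eq_conjTranspose,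
        Matrix.conjTranspose_eq_transpose_of_trivial] at this
      simpa using this
  set H := Mᵀ * M with hHdef
  set G : Matrix κ κ ℝ := U * Matrix.diagonal (fun i => (D i)⁻¹) * Uᵀ with hG
  have hmul : ∀ a b : κ → ℝ, (U * Matrix.diagonal a * Uᵀ) * (U * Matrix.diagonal b * Uᵀ)
      = U * Matrix.diagonal (fun i => a i * b i) * Uᵀ := by
    intro a b
    calc (U * Matrix.diagonal a * Uᵀ) * (U * Matrix.diagonal b * Uᵀ)
        = U * Matrix.diagonal a * (Uᵀ * U) * Matrix.diagonal b * Uᵀ := by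
          simp only [Matrix.mul_assoc]
      _ = _ := by rw [hU, Matrix.mul_one, Matrix.mul_assoc U, Matrix.diagonal_mul_diagonal]
  have htr : ∀ a : κ → ℝ, (U * Matrix.diagonal a * Uᵀ)ᵀ = U * Matrix.diagonal a * Uᵀ := by
    intro a
    simp [Matrix.transpose_mul, Matrix.mul_assoc]
  have hGT : Gᵀ = G := htr _
  have hHT : Hᵀ = H := by rw [hUH]; exact htr _
  have hGH : G * H = U * Matrix.diagonal (fun i => (D i)⁻¹ * D i) * Uᵀ := by
    rw [hUH, hG, hmul]
  have hGHT : (G * H)ᵀ = G * H := by rw [hGH]; exact htr _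
  have hHG : H * G = G * H := by
    rw [← hGHT, Matrix.transpose_mul, hGT, hHT]
  have hGHG : G * H * G = G := by
    rw [hGH, hG, hmul]
    congr 3
    funext i
    by_cases h : D i = 0 <;> simp [h]
  have hHGH : H * (G * H) = H := by
    rw [hGH, hUH, hmul]
    congr 3
    funext i
    by_cases h : D i = 0 <;> simp [h]
  have hM : M * (G * H) = M := by
    have h0 : (M * (G * H) - M)ᵀ * (M * (G * H) - M) = 0 := by
      have : (M * (G * H) - M)ᵀ * (M * (G * H) - M)
          = (G * H)ᵀ * (H * (G * H)) - (G * H)ᵀ * H - (H * (G * H) - H) := by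
        rw [hHdef]
        simp only [Matrix.transpose_sub, Matrix.transpose_mul, Matrix.sub_mul, Matrix.mul_sub,
          Matrix.mul_assoc]
        abel
      rw [this, hHGH]
      simp
    have h1 := Matrix.conjTranspose_mul_self_eq_zero (A := M * (G * H) - M)
    rw [Matrix.conjTranspose_eq_transpose_of_trivial] at h1
    exact sub_eq_zero.mp (h1.mp h0)
  refine ⟨G * Mᵀ, ?_, ?_, ?_, ?_⟩
  · calc M * (G * Mᵀ) * M = M * (G * H) := by simp only [hHdef, Matrix.mul_assoc]
      _ = M := hM
  · calc G * Mᵀ * M * (G * Mᵀ) = (G * H * G) * Mᵀ := by simp only [hHdef, Matrix.mul_assoc]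
      _ = G * Mᵀ := by rw [hGHG]
  · simp [Matrix.transpose_mul, hGT, Matrix.mul_assoc]
  · have : G * Mᵀ * M = G * H := by simp only [hHdef, Matrix.mul_assoc]
    rw [this, hGHT]

theorem IsPseudoinverse.unique {ι κ : Type*} [Fintype ι] [Fintype κ]
    {M : Matrix ι κ ℝ} {A B : Matrix κ ι ℝ}
    (hA : IsPseudoinverse M A) (hB : IsPseudoinverse M B) : A = B := by
  obtain ⟨a1, a2, a3, a4⟩ := hA
  obtain ⟨b1, b2, b3, b4⟩ := hB
  have h1 : M * A = M * B := by
    calc M * A = (M * B * M) * A := by rw [b1]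
      _ = (M * B) * (M * A) := by simp only [Matrix.mul_assoc]
      _ = (M * B)ᵀ * (M * A)ᵀ := by rw [a3, b3]
      _ = ((M * A * M) * B)ᵀ := by simp only [← Matrix.transpose_mul, Matrix.mul_assoc]
      _ = M * B := by rw [a1, b3]
  have h2 : A * M = B * M := by
    calc A * M = A * (M * B * M) := by rw [b1]
      _ = (A * M) * (B * M) := by simp only [Matrix.mul_assoc]
      _ = (A * M)ᵀ * (B * M)ᵀ := by rw [a4, b4]
      _ = (B * (M * A * M))ᵀ := by simp only [← Matrix.transpose_mul, Matrix.mul_assoc]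
      _ = B * M := by rw [a1, b4]
  calc A = A * M * A := a2.symm
    _ = B * (M * A) := by rw [h2, Matrix.mul_assoc]
    _ = B * M * B := by rw [h1, Matrix.mul_assoc]
    _ = B := b2

/-- The Moore–Penrose pseudoinverse `M†`. -/
def pinv {ι κ : Type*} [Fintype ι] [Fintype κ] (M : Matrix ι κ ℝ) : Matrix κ ι ℝ :=
  (exists_isPseudoinverse M).choose

theorem pinv_spec {ι κ : Type*} [Fintype ι] [Fintype κ] (M : Matrix ι κ ℝ) :
    IsPseudoinverse M (pinv M) :=
  (exists_isPseudoinverse M).choose_spec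

/-! ### Measures, the operator `Φ` and the primal problem -/

/-- The parameter space `ℝ^d`, and also the observation space `ℝ^n`. -/
abbrev Euc (d : ℕ) : Type := EuclideanSpace ℝ (Fin d)

/-- `|m|_TV = |m|(Ω)`. The Radon measures on the Borel set `Ω` are the finite signed Borel
measures on the subtype `Ω`. -/
def tvNorm {d : ℕ} {Ω : Set (Euc d)} (m : SignedMeasure Ω) : ℝ :=
  (m.variation univ).toReal

/-- The forward operator `Φ m = ∫_Ω φ dm`. -/
def Phi {d n : ℕ} (Ω : Set (Euc d)) (φ : Euc d → Euc n) (m : SignedMeasure Ω) : Euc n :=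
  VectorMeasure.integral m (fun x : Ω => φ x) (ContinuousLinearMap.lsmul ℝ ℝ).flip

/-- The Blasso objective `½ ‖Φ m - y‖² + λ |m|_TV`. -/
def objective {d n : ℕ} (Ω : Set (Euc d)) (φ : Euc d → Euc n) (lam : ℝ) (y : Euc n)
    (m : SignedMeasure Ω) : ℝ :=
  (1 / 2) * ‖Phi Ω φ m - y‖ ^ 2 + lam * tvNorm m

/-- `m` solves the Blasso problem `P_λ(y)`. -/
def IsSolution {d n : ℕ} (Ω : Set (Euc d)) (φ : Euc d → Euc n) (lam : ℝ) (y : Euc n)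
    (m : SignedMeasure Ω) : Prop :=
  ∀ m' : SignedMeasure Ω, objective Ω φ lam y m ≤ objective Ω φ lam y m'

/-- `m_{β,X} = ∑ j, β_j δ_{x_j}`. -/
def discreteMeasure {d : ℕ} {Ω : Set (Euc d)} {k : ℕ} (β : Fin k → ℝ) (X : Fin k → Ω) :
    SignedMeasure Ω :=
  ∑ j, VectorMeasure.dirac (X j) (β j)

/-- The matrix `Φ_X` with columns `φ(x_j)`. -/
def PhiMat {d n : ℕ} {Ω : Set (Euc d)} (φ : Euc d → Euc n) {k : ℕ} (X : Fin k → Ω) :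
    Matrix (Fin n) (Fin k) ℝ :=
  Matrix.of fun i j => φ (X j) i

/-- The subdifferential of the total variation norm,
`∂|m|_TV = {f ∈ C(Ω) : ∫ f dm = |m|_TV and ‖f‖_∞ ≤ 1}`. -/
def tvSubdifferential {d : ℕ} {Ω : Set (Euc d)} (m : SignedMeasure Ω) : Set (Ω → ℝ) :=
  {f | Continuous f ∧ (∀ x, |f x| ≤ 1) ∧
    VectorMeasure.integral m f (ContinuousLinearMap.lsmul ℝ ℝ).flip = tvNorm m}

/-- The estimator `μ̂(y) = Φ m`, for `m` a solution of `P_λ(y)` (the value does not depend on the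
solution). -/
def muHat {d n : ℕ} (Ω : Set (Euc d)) (φ : Euc d → Euc n) (lam : ℝ) (y : Euc n) : Euc n :=
  open scoped Classical in
  if h : ∃ m, IsSolution Ω φ lam y m then Phi Ω φ h.choose else 0

/-- The divergence `∑ i, ∂_i f_i` of a vector field. -/
def divergence {n : ℕ} (f : Euc n → Euc n) (y : Euc n) : ℝ :=
  ∑ i, (fderiv ℝ f y (EuclideanSpace.single i 1)) i

/-! ### Dual problem, dual certificate, extended support -/

/-- `(Φ^* p)(x) = ⟨φ(x), p⟩`. -/
def PhiAdj {d n : ℕ} (φ : Euc d → Euc n) (p : Euc n) (x : Euc d) : ℝ :=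
  inner ℝ (φ x) p

/-- The constraint set `{p : ‖Φ^* p‖_∞ ≤ 1}` of the dual problem. -/
def dualFeasible {d n : ℕ} (Ω : Set (Euc d)) (φ : Euc d → Euc n) : Set (Euc n) :=
  {p | ∀ x ∈ Ω, |PhiAdj φ p x| ≤ 1}

/-- `p` solves the dual problem `D_λ(y)`: it minimizes `‖p - y/λ‖` over the constraint set. -/
def IsDualSolution {d n : ℕ} (Ω : Set (Euc d)) (φ : Euc d → Euc n) (lam : ℝ) (y p : Euc n) :
    Prop :=
  p ∈ dualFeasible Ω φ ∧ ∀ q ∈ dualFeasible Ω φ, ‖p - lam⁻¹ • y‖ ≤ ‖q - lam⁻¹ • y‖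

theorem exists_isDualSolution {d n : ℕ} (Ω : Set (Euc d)) (φ : Euc d → Euc n) (lam : ℝ)
    (y : Euc n) : ∃ p, IsDualSolution Ω φ lam y p := by
  have hset : dualFeasible Ω φ = ⋂ x ∈ Ω, {p : Euc n | |inner ℝ (φ x) p| ≤ 1} := by
    ext p; simp [dualFeasible, PhiAdj]
  have hclosed : IsClosed (dualFeasible Ω φ) := by
    rw [hset]
    refine isClosed_biInter fun x _ => isClosed_le ?_ continuous_const
    fun_prop
  obtain ⟨p, hp, hmin⟩ := hclosed.exists_infDist_eq_dist
    ⟨0, by intro x _; simp [PhiAdj]⟩ (lam⁻¹ • y)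
  refine ⟨p, hp, fun q hq => ?_⟩
  have h := Metric.infDist_le_dist_of_mem (x := lam⁻¹ • y) hq
  rw [hmin, dist_comm, dist_comm _ q, dist_eq_norm, dist_eq_norm] at h
  exact h

/-- The dual solution `p_y`. It is unique, the constraint set being closed and convex. -/
def dualSol {d n : ℕ} (Ω : Set (Euc d)) (φ : Euc d → Euc n) (lam : ℝ) (y : Euc n) : Euc n :=
  (exists_isDualSolution Ω φ lam y).choose

/-- The dual certificate `η_y = Φ^* p_y`. -/
def certificate {d n : ℕ} (Ω : Set (Euc d)) (φ : Euc d → Euc n) (lam : ℝ) (y : Euc n) :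
    Euc d → ℝ :=
  PhiAdj φ (dualSol Ω φ lam y)

/-- The extended support `E_y = {x ∈ Ω : |η_y(x)| = 1}`. -/
def extSupport {d n : ℕ} (Ω : Set (Euc d)) (φ : Euc d → Euc n) (lam : ℝ) (y : Euc n) :
    Set (Euc d) :=
  {x | x ∈ Ω ∧ |certificate Ω φ lam y x| = 1}

/-- The Hessian matrix of a function at a point. -/
def hessian {d : ℕ} (f : Euc d → ℝ) (x : Euc d) : Matrix (Fin d) (Fin d) ℝ :=
  Matrix.of fun i j =>
    iteratedFDeriv ℝ 2 f x ![EuclideanSpace.single i 1, EuclideanSpace.single j 1]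

/-- Assumption (A1): the extended support is finite and `η_y(x) ∇²η_y(x) ≺ 0` on it. -/
def AssumptionA1 {d n : ℕ} (Ω : Set (Euc d)) (φ : Euc d → Euc n) (lam : ℝ) (y : Euc n) : Prop :=
  (extSupport Ω φ lam y).Finite ∧
    ∀ x ∈ extSupport Ω φ lam y,
      (-(certificate Ω φ lam y x • hessian (certificate Ω φ lam y) x)).PosDef

/-! ### The exceptional set -/

/-- The vector `(M† + M_S† M_{Sᶜ} (M†)_{(Sᶜ,·)}) (y - (Mᵀ)† λ σ)`, restricted to the indices in
`S`; here `M† ` contributes its rows indexed by `S`. -/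
def transferVec {n k : ℕ} (M : Matrix (Fin n) (Fin k) ℝ) (S : Finset (Fin k)) (lam : ℝ)
    (σ : Fin k → ℝ) (y : Euc n) : S → ℝ :=
  let MS : Matrix (Fin n) S ℝ := M.submatrix id Subtype.val
  let MSc : Matrix (Fin n) (Sᶜ : Finset (Fin k)) ℝ := M.submatrix id Subtype.val
  let PS : Matrix S (Fin n) ℝ := (pinv M).submatrix Subtype.val id
  let PSc : Matrix (Sᶜ : Finset (Fin k)) (Fin n) ℝ := (pinv M).submatrix Subtype.val id
  (PS + pinv MS * MSc * PSc) *ᵥ ((y : Fin n → ℝ) - pinv Mᵀ *ᵥ (lam • σ))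

/-- The set `Q_{k,S,σ,I}` of triples `(y, a, E)`: `E` consists of `k` pairwise distinct points of the
extended support at `y`, `Φ^*(y - Φ_E a) ∈ λ ∂|m_{a,E}|_TV`, the matrix `M = Φ_E` has rank `|S|`, and
the entries with index in `I` of the vector above vanish. -/
def Q {d n : ℕ} (Ω : Set (Euc d)) (φ : Euc d → Euc n) (lam : ℝ) (k : ℕ) (S : Finset (Fin k))
    (σ : Fin k → ℝ) (I : Finset (Fin k)) : Set (Euc n × (Fin k → ℝ) × (Fin k → Ω)) :=
  {q | Function.Injective q.2.2 ∧
    (∀ j, (q.2.2 j : Euc d) ∈ extSupport Ω φ lam q.1) ∧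
    (∃ f ∈ tvSubdifferential (discreteMeasure q.2.1 q.2.2), ∀ x : Ω,
      PhiAdj φ (q.1 - WithLp.toLp 2 (PhiMat φ q.2.2 *ᵥ q.2.1)) x = lam * f x) ∧
    (PhiMat φ q.2.2).rank = S.card ∧
    ∀ i : S, (i : Fin k) ∈ I → transferVec (PhiMat φ q.2.2) S lam σ q.1 i = 0}

/-- The exceptional set `H`: the union of the boundaries of the projections `Π_Y(Q_{k,S,σ,I})` over
`k ≥ 1`, `σ ∈ {-1,1}^k`, `S ⊆ [k]` and `I ⊆ S`. -/
def exceptionalSet {d n : ℕ} (Ω : Set (Euc d)) (φ : Euc d → Euc n) (lam : ℝ) : Set (Euc n) :=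
  {y | ∃ k : ℕ, 1 ≤ k ∧ ∃ σ : Fin k → ℝ, (∀ j, σ j = -1 ∨ σ j = 1) ∧
    ∃ S : Finset (Fin k), ∃ I : Finset (Fin k), I ⊆ S ∧
      y ∈ frontier (Prod.fst '' Q Ω φ lam k S σ I)}

/-! ### Supports selected from the extended support; the divergence formula -/

/-- `X` enumerates a subset of `E_y` such that `Φ_X` is injective, and `m_{β,X}` solves `P_λ(y)`,
all the amplitudes `β_j` being nonzero. -/
def IsInjectiveSolution {d n : ℕ} (Ω : Set (Euc d)) (φ : Euc d → Euc n) (lam : ℝ) (y : Euc n)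
    {k : ℕ} (β : Fin k → ℝ) (X : Fin k → Ω) : Prop :=
  Function.Injective X ∧ (∀ j, (X j : Euc d) ∈ extSupport Ω φ lam y) ∧
    Function.Injective (PhiMat φ X).mulVec ∧ (∀ j, β j ≠ 0) ∧
    IsSolution Ω φ lam y (discreteMeasure β X)

/-- The matrix `Γ_X = [Φ_X, Φ_X^{(1)}]`: values and first partial derivatives of `φ` at the `x_j`. -/
def Gam {d n : ℕ} {Ω : Set (Euc d)} (φ : Euc d → Euc n) {k : ℕ} (X : Fin k → Ω) :
    Matrix (Fin n) (Fin k ⊕ Fin d × Fin k) ℝ :=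
  Matrix.fromCols (PhiMat φ X)
    (Matrix.of fun i lj => (fderiv ℝ φ (X lj.2) (EuclideanSpace.single lj.1 1)) i)

/-- The matrix `Γ_Xᵀ Γ_X + diag(0, Q_1, …, Q_k)` with `Q_j = -(λ/β_j) ∇²η_y(x_j)`. -/
def curvatureMat {d n : ℕ} (Ω : Set (Euc d)) (φ : Euc d → Euc n) (lam : ℝ) (y : Euc n)
    {k : ℕ} (β : Fin k → ℝ) (X : Fin k → Ω) :
    Matrix (Fin k ⊕ Fin d × Fin k) (Fin k ⊕ Fin d × Fin k) ℝ :=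
  (Gam φ X)ᵀ * Gam φ X +
    Matrix.fromBlocks 0 0 0
      (Matrix.blockDiagonal fun j => (-(lam / β j)) • hessian (certificate Ω φ lam y) (X j))

end Blasso

end

/-!
The dual solution `p_y` is the projection of `y / λ` onto a closed convex set, and `μ̂(y) = y - λ p_y`:
a measure `m` with `Φ m = y - λ p_y` and `⟨Φ m, p_y⟩ = |m|_TV` solves the problem, and every solution
has these two properties (`objective_add_le_of_certificate`, `IsSolution.eq_of_certificate`). When
the extended support is finite, first order optimality of the projection, a separation argument and
Carathéodory's theorem give such an `m` carried by points at which the values of `φ` are linearly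
independent (`exists_isInjectiveSolution`). Everything else is about how `p_{y'}` varies with `y'`.

Let `(β, A)` be a solution with `Φ_A` injective. Its amplitudes and positions satisfy the
stationarity equations `⟨φ(x_j), r⟩ = λ σ_j`, `⟨Dφ(x_j) ·, r⟩ = 0` with `r = y - ∑ β_j φ(x_j)`. By
(A1) these are nondegenerate, so they have a `C¹` solution near `y`
(`IsNondegenerate.exists_implicit`); after the scaling `v_j ↦ β_j v_j` of the displacements their
linearization is the curvature matrix, which gives the divergence formula
(`curvatureMat_mulVec_eq_iff`, `divergence_eq_trace`).

It remains to see that this solution of the stationarity equations solves the problem at `y'`, which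
could fail if `A` missed a point of the extended support that becomes active. Here `y ∉ H` enters.

* By (A1), for `y'` near `y` every point of `E_{y'}` is near a point of `E_y`, and there is at most one
  near each, at a distance `O(‖p_{y'} - p_y‖)` (`IsControlled`, `exists_matching`).
* If `E_{y'}` has as many points as `E_y` for all `y'` near `y`, then `p_{y + u} = p_y` for all small `u`
  in the span of the `φ(x)`, `x ∈ E_y` (`eventually_dualSol_eq`).
* Enumerate `E_y` by a tuple `E`, put `M = Φ_E`, and complete `A` to a set `S` of columns forming a basis
  of the range of `M`. The transfer vector then holds the coefficients of `y - λ p_y` in this basis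
  (`transferVec_apply_eq`), so that its entries in `S \ A` vanish and `y` lies in the projection of
  `Q_{K,S,σ,I}` for every `I ⊆ S \ A`; as `y ∉ H`, so do all nearby `y'`. An `i ∈ S \ A` is impossible:
  with `I = {i}`, the entry `i` of the transfer vector would vanish at all `y + u` as above, for one of the
  finitely many orderings of `E_y`, whereas for each ordering this entry is a nonconstant affine
  function of `u` (`exists_transferMat_mulVec_ne_zero`).
* Hence `A` has as many points as the rank of `M`. With `I = ∅`, the number of points of `E_{y'}` and the
  rank of `φ` on them are constant near `y`, so `y' - λ p_{y'}` is a combination of the values of `φ` at the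
  points of `E_{y'}` matched with `A`. Those points and the coefficients solve the stationarity
  equations, and local uniqueness identifies them with the implicit solution (`eventually_tracking`).
-/

noncomputable section

namespace Blasso

/-! ### Integration against signed measures -/

theorem isFiniteMeasure_variation {X : Type*} [MeasurableSpace X] (m : SignedMeasure X) :
    IsFiniteMeasure m.variation := by
  rw [← SignedMeasure.totalVariation_eq_variation]
  unfold SignedMeasure.totalVariation
  infer_instance

/-- Integration against a signed measure is the difference of the Bochner integrals against the two
parts of its Jordan decomposition. -/
theorem integral_eq_sub_jordan {X G : Type*} [MeasurableSpace X] [NormedAddCommGroup G]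
    [NormedSpace ℝ G] [CompleteSpace G] (m : SignedMeasure X) {f : X → G}
    (hf : MeasureTheory.Integrable f m.variation) :
    VectorMeasure.integral m f (ContinuousLinearMap.lsmul ℝ ℝ).flip =
      ∫ x, f x ∂m.toJordanDecomposition.posPart - ∫ x, f x ∂m.toJordanDecomposition.negPart := by
  rw [← SignedMeasure.totalVariation_eq_variation, SignedMeasure.totalVariation,
    integrable_add_measure] at hf
  have h := VectorMeasure.integral_sub_vectorMeasure
    (μ := m.toJordanDecomposition.posPart.toSignedMeasure)
    (ν := m.toJordanDecomposition.negPart.toSignedMeasure) (f := f)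
    (B := (ContinuousLinearMap.lsmul ℝ ℝ (E := G)).flip) 
    (by rw [VectorMeasure.Integrable, Measure.variation_toSignedMeasure]; exact hf.1)
    (by rw [VectorMeasure.Integrable, Measure.variation_toSignedMeasure]; exact hf.2)
  have hm : m.toJordanDecomposition.posPart.toSignedMeasure
      - m.toJordanDecomposition.negPart.toSignedMeasure = m :=
    SignedMeasure.toSignedMeasure_toJordanDecomposition m
  rw [hm] at h
  rw [h]
  simp

theorem continuousLinearMap_integral_comm {X G H : Type*} [MeasurableSpace X]
    [NormedAddCommGroup G] [NormedSpace ℝ G] [CompleteSpace G] [NormedAddCommGroup H]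
    [NormedSpace ℝ H] [CompleteSpace H] (m : SignedMeasure X) {f : X → G}
    (hf : MeasureTheory.Integrable f m.variation) (T : G →L[ℝ] H) :
    T (VectorMeasure.integral m f (ContinuousLinearMap.lsmul ℝ ℝ).flip) =
      VectorMeasure.integral m (fun x => T (f x)) (ContinuousLinearMap.lsmul ℝ ℝ).flip := by
  rw [integral_eq_sub_jordan m hf, integral_eq_sub_jordan m (T.integrable_comp hf), map_sub]
  rw [← SignedMeasure.totalVariation_eq_variation, SignedMeasure.totalVariation,
    integrable_add_measure] at hf
  rw [T.integral_comp_comm hf.1, T.integral_comp_comm hf.2]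

variable {d n : ℕ} {Ω : Set (Euc d)}

theorem integral_le_tvNorm (m : SignedMeasure Ω) {f : Ω → ℝ} (hf : ∀ x, |f x| ≤ 1) :
    VectorMeasure.integral m f (ContinuousLinearMap.lsmul ℝ ℝ).flip ≤ tvNorm m := by
  have := isFiniteMeasure_variation m
  have h := VectorMeasure.norm_integral_le_of_norm_le_const (μ := m) (f := f) (C := 1)
    (B := (ContinuousLinearMap.lsmul ℝ ℝ (E := ℝ)).flip) (Eventually.of_forall hf)
  have hB : ‖(ContinuousLinearMap.lsmul ℝ ℝ (E := ℝ)).flip‖ ≤ 1 := by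
    rw [ContinuousLinearMap.opNorm_flip]
    exact ContinuousLinearMap.opNorm_lsmul_le
  refine (le_abs_self _).trans (h.trans ?_)
  have h0 : 0 ≤ m.variation.real univ := measureReal_nonneg
  calc 1 * ‖(ContinuousLinearMap.lsmul ℝ ℝ (E := ℝ)).flip‖ * m.variation.real univ
      ≤ 1 * 1 * m.variation.real univ := by gcongr
    _ = tvNorm m := by simp [tvNorm, Measure.real]

theorem integral_discreteMeasure {G : Type*} [NormedAddCommGroup G] [NormedSpace ℝ G]
    [CompleteSpace G] {k : ℕ} (β : Fin k → ℝ) (X : Fin k → Ω) (f : Ω → G) :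
    VectorMeasure.integral (discreteMeasure β X) f (ContinuousLinearMap.lsmul ℝ ℝ).flip =
      ∑ j, β j • f (X j) := by
  unfold discreteMeasure
  rw [VectorMeasure.integral_finsetSum_vectorMeasure]
  · simp [VectorMeasure.integral_dirac]
  · intro i _
    rw [VectorMeasure.Integrable, VectorMeasure.variation_dirac]
    exact (integrable_dirac (by simp)).smul_measure (by simp)

theorem tvNorm_discreteMeasure_le {k : ℕ} (β : Fin k → ℝ) (X : Fin k → Ω) :
    tvNorm (discreteMeasure β X) ≤ ∑ j, |β j| := by
  have h : (discreteMeasure β X).variation ≤ ∑ j, (VectorMeasure.dirac (X j) (β j)).variation :=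
    VectorMeasure.variation_finsetSum_le _ _
  have h1 := h univ
  simp only [VectorMeasure.variation_dirac, Measure.finsetSum_apply, Measure.smul_apply,
    measure_univ, smul_eq_mul, mul_one] at h1
  have h2 : ∑ j, ‖β j‖ₑ = ENNReal.ofReal (∑ j, |β j|) := by
    rw [ENNReal.ofReal_sum_of_nonneg fun _ _ => abs_nonneg _]
    exact Finset.sum_congr rfl fun j _ => Real.enorm_eq_ofReal_abs _
  rw [h2] at h1
  exact ENNReal.toReal_le_of_le_ofReal (Finset.sum_nonneg fun _ _ => abs_nonneg _) h1

/-- The lower bound comes from integrating a function that takes the value `sign β_j` at `x_j`. -/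
theorem le_tvNorm_discreteMeasure {k : ℕ} (β : Fin k → ℝ) (X : Fin k → Ω)
    (hX : Function.Injective X) : ∑ j, |β j| ≤ tvNorm (discreteMeasure β X) := by
  have h := integral_le_tvNorm (discreteMeasure β X)
    (f := Function.extend X (fun j => (SignType.sign (β j) : ℝ)) 0) (by
      intro x
      by_cases hx : ∃ j, X j = x
      · obtain ⟨j, rfl⟩ := hx
        rw [hX.extend_apply]
        rcases lt_trichotomy (β j) 0 with h | h | h <;> simp [h]
      · rw [Function.extend_apply' _ _ _ hx]; simp)
  rw [integral_discreteMeasure] at h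
  simpa [hX.extend_apply] using h

/-! ### The operator `Φ` and its adjoint -/

theorem PhiAdj_add (φ : Euc d → Euc n) (p q : Euc n) (x : Euc d) :
    PhiAdj φ (p + q) x = PhiAdj φ p x + PhiAdj φ q x := inner_add_right _ _ _

theorem PhiAdj_sub (φ : Euc d → Euc n) (p q : Euc n) (x : Euc d) :
    PhiAdj φ (p - q) x = PhiAdj φ p x - PhiAdj φ q x := inner_sub_right _ _ _

theorem PhiAdj_smul (φ : Euc d → Euc n) (c : ℝ) (p : Euc n) (x : Euc d) :
    PhiAdj φ (c • p) x = c * PhiAdj φ p x := real_inner_smul_right _ _ _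

theorem abs_PhiAdj_le (φ : Euc d → Euc n) (p : Euc n) (x : Euc d) :
    |PhiAdj φ p x| ≤ ‖φ x‖ * ‖p‖ := abs_real_inner_le_norm _ _

/-- A continuous function on `Ω` vanishing at infinity is bounded. -/
theorem exists_norm_le {φ : Euc d → Euc n} (hφ : ContinuousOn φ Ω)
    (hφ0 : Tendsto (fun x : Ω => φ x) (cocompact Ω) (𝓝 0)) :
    ∃ C, 0 < C ∧ ∀ x ∈ Ω, ‖φ x‖ ≤ C := by
  have hc : Continuous fun x : Ω => φ x := continuousOn_iff_continuous_domRestrict.mp hφ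
  have h1 : ∀ᶠ x : Ω in cocompact Ω, ‖φ x‖ < 1 := by
    have := hφ0.norm
    rw [norm_zero] at this
    exact this.eventually_lt_const one_pos
  obtain ⟨K, hK, hK1⟩ := mem_cocompact.mp h1
  obtain ⟨B, hB⟩ := hK.exists_bound_of_continuousOn hc.continuousOn
  refine ⟨max B 1, by positivity, fun x hx => ?_⟩
  by_cases hxK : (⟨x, hx⟩ : Ω) ∈ K
  · exact (hB _ hxK).trans (le_max_left _ _)
  · exact (le_of_lt (hK1 hxK)).trans (le_max_right _ _)

theorem integrable_phi {φ : Euc d → Euc n} (hφ : ContinuousOn φ Ω)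
    (hφ0 : Tendsto (fun x : Ω => φ x) (cocompact Ω) (𝓝 0)) (m : SignedMeasure Ω) :
    MeasureTheory.Integrable (fun x : Ω => φ x) m.variation := by
  have := isFiniteMeasure_variation m
  have hc : Continuous fun x : Ω => φ x := continuousOn_iff_continuous_domRestrict.mp hφ
  obtain ⟨C, _, hC⟩ := exists_norm_le hφ hφ0
  exact Integrable.of_bound hc.aestronglyMeasurable C (Eventually.of_forall fun x => hC x x.2)

theorem inner_Phi {φ : Euc d → Euc n} (hφ : ContinuousOn φ Ω)
    (hφ0 : Tendsto (fun x : Ω => φ x) (cocompact Ω) (𝓝 0)) (m : SignedMeasure Ω) (p : Euc n) :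
    inner ℝ (Phi Ω φ m) p =
      VectorMeasure.integral m (fun x : Ω => PhiAdj φ p x)
        (ContinuousLinearMap.lsmul ℝ ℝ).flip := by
  have h := continuousLinearMap_integral_comm m (integrable_phi hφ hφ0 m) (innerSL ℝ p)
  simp only [innerSL_apply_apply] at h
  rw [real_inner_comm, Phi, h]
  simp only [PhiAdj, real_inner_comm]

theorem inner_Phi_le_tvNorm {φ : Euc d → Euc n} (hφ : ContinuousOn φ Ω)
    (hφ0 : Tendsto (fun x : Ω => φ x) (cocompact Ω) (𝓝 0)) (m : SignedMeasure Ω) {p : Euc n}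
    (hp : p ∈ dualFeasible Ω φ) : inner ℝ (Phi Ω φ m) p ≤ tvNorm m := by
  rw [inner_Phi hφ hφ0]
  exact integral_le_tvNorm m fun x => hp x x.2

theorem Phi_discreteMeasure (φ : Euc d → Euc n) {k : ℕ} (β : Fin k → ℝ) (X : Fin k → Ω) :
    Phi Ω φ (discreteMeasure β X) = ∑ j, β j • φ (X j) :=
  integral_discreteMeasure β X fun x : Ω => φ x

theorem toLp_PhiMat_mulVec (φ : Euc d → Euc n) {k : ℕ} (X : Fin k → Ω) (a : Fin k → ℝ) :
    WithLp.toLp 2 (PhiMat φ X *ᵥ a) = ∑ j, a j • φ (X j) := by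
  ext i
  simp [PhiMat, Matrix.mulVec, dotProduct, mul_comm]

/-! ### Duality -/

variable {φ : Euc d → Euc n} {lam : ℝ}

theorem dualFeasible_convex : Convex ℝ (dualFeasible Ω φ) := by
  intro p hp q hq a b ha hb hab x hx
  rw [PhiAdj_add, PhiAdj_smul, PhiAdj_smul]
  have h1 := abs_le.mp (hp x hx)
  have h2 := abs_le.mp (hq x hx)
  rw [abs_le]
  constructor <;> nlinarith [h1.1, h1.2, h2.1, h2.2]

theorem dualSol_spec (Ω : Set (Euc d)) (φ : Euc d → Euc n) (lam : ℝ) (y : Euc n) :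
    IsDualSolution Ω φ lam y (dualSol Ω φ lam y) :=
  (exists_isDualSolution Ω φ lam y).choose_spec

theorem dualSol_feasible (Ω : Set (Euc d)) (φ : Euc d → Euc n) (lam : ℝ) (y : Euc n) :
    dualSol Ω φ lam y ∈ dualFeasible Ω φ := (dualSol_spec Ω φ lam y).1

/-- The variational inequality of the projection `p_y`. -/
theorem dualSol_inner_le (hlam : 0 < lam) (y : Euc n) {q : Euc n} (hq : q ∈ dualFeasible Ω φ) :
    inner ℝ (y - lam • dualSol Ω φ lam y) (q - dualSol Ω φ lam y) ≤ 0 := by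
  obtain ⟨hp, hmin⟩ := dualSol_spec Ω φ lam y
  set p := dualSol Ω φ lam y
  have key : inner ℝ (lam⁻¹ • y - p) (q - p) ≤ 0 := by
    refine (norm_eq_iInf_iff_real_inner_le_zero dualFeasible_convex hp).mp ?_ q hq
    have : Nonempty (dualFeasible Ω φ) := ⟨⟨p, hp⟩⟩
    refine le_antisymm (le_ciInf fun w => ?_)
      (ciInf_le ⟨0, by rintro _ ⟨w, rfl⟩; positivity⟩ (⟨p, hp⟩ : dualFeasible Ω φ))
    rw [norm_sub_rev, norm_sub_rev _ (w : Euc n)]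
    exact hmin w w.2
  have : y - lam • p = lam • (lam⁻¹ • y - p) := by
    rw [smul_sub, smul_inv_smul₀ hlam.ne']
  rw [this, real_inner_smul_left]
  exact mul_nonpos_of_nonneg_of_nonpos hlam.le key

/-- The projection onto a convex set is nonexpansive. -/
theorem dualSol_lipschitz (hlam : 0 < lam) (y y' : Euc n) :
    lam * ‖dualSol Ω φ lam y' - dualSol Ω φ lam y‖ ≤ ‖y' - y‖ := by
  have h1 := dualSol_inner_le hlam y (dualSol_feasible Ω φ lam y')
  have h2 := dualSol_inner_le hlam y' (dualSol_feasible Ω φ lam y)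
  set p := dualSol Ω φ lam y
  set p' := dualSol Ω φ lam y'
  have e : lam * ‖p' - p‖ ^ 2 = inner ℝ (y' - y) (p' - p) +
      (inner ℝ (y - lam • p) (p' - p) + inner ℝ (y' - lam • p') (p - p')) := by
    rw [← real_inner_self_eq_norm_sq]
    simp only [inner_sub_left, inner_sub_right, real_inner_smul_left, real_inner_comm p p']
    ring
  have h3 := real_inner_le_norm (y' - y) (p' - p)
  rcases (norm_nonneg (p' - p)).eq_or_lt with h0 | h0
  · rw [← h0]; simp
  · have : lam * ‖p' - p‖ * ‖p' - p‖ ≤ ‖y' - y‖ * ‖p' - p‖ := by nlinarith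
    exact le_of_mul_le_mul_right this h0

/-- If `p = (y - Φ m) / λ` satisfies `⟨Φ m, p⟩ = |m|_TV`, then the objective exceeds its value at `m`
by a duality gap, which is nonnegative for feasible `p`, plus a quadratic term in `Φ m`. -/
theorem objective_add_le_of_certificate (hlam : 0 < lam) {y p : Euc n}
    {m : SignedMeasure Ω} (hm : y - lam • p = Phi Ω φ m)
    (htv : tvNorm m ≤ inner ℝ (Phi Ω φ m) p) (m' : SignedMeasure Ω) :
    objective Ω φ lam y m + lam * (tvNorm m' - inner ℝ (Phi Ω φ m') p)
      + 1 / 2 * ‖Phi Ω φ m' - Phi Ω φ m‖ ^ 2 ≤ objective Ω φ lam y m' := by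
  unfold objective
  have e : Phi Ω φ m' - y = (Phi Ω φ m' - Phi Ω φ m) - lam • p := by rw [← hm]; abel
  have e2 : Phi Ω φ m - y = - (lam • p) := by rw [← hm]; abel
  rw [e, e2, norm_sub_sq_real (Phi Ω φ m' - Phi Ω φ m), norm_neg, inner_sub_left, real_inner_smul_right,
    real_inner_smul_right]
  nlinarith [mul_le_mul_of_nonneg_left htv hlam.le]

theorem isSolution_of_certificate (hφ : ContinuousOn φ Ω)
    (hφ0 : Tendsto (fun x : Ω => φ x) (cocompact Ω) (𝓝 0)) (hlam : 0 < lam) {y p : Euc n}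
    {m : SignedMeasure Ω} (hm : y - lam • p = Phi Ω φ m) (hp : p ∈ dualFeasible Ω φ)
    (htv : tvNorm m ≤ inner ℝ (Phi Ω φ m) p) : IsSolution Ω φ lam y m := by
  intro m'
  have h := objective_add_le_of_certificate hlam hm htv m'
  have h2 := inner_Phi_le_tvNorm hφ hφ0 m' hp
  nlinarith [sq_nonneg ‖Phi Ω φ m' - Phi Ω φ m‖, mul_nonneg hlam.le (sub_nonneg.mpr h2)]

/-- Every solution has the same image under `Φ`, and is aligned with the same certificate. -/
theorem IsSolution.eq_of_certificate (hφ : ContinuousOn φ Ω)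
    (hφ0 : Tendsto (fun x : Ω => φ x) (cocompact Ω) (𝓝 0)) (hlam : 0 < lam) {y p : Euc n}
    {m : SignedMeasure Ω} (hm : y - lam • p = Phi Ω φ m) (hp : p ∈ dualFeasible Ω φ)
    (htv : tvNorm m ≤ inner ℝ (Phi Ω φ m) p) {m' : SignedMeasure Ω}
    (h' : IsSolution Ω φ lam y m') :
    Phi Ω φ m' = y - lam • p ∧ tvNorm m' = inner ℝ (Phi Ω φ m') p := by
  have h := objective_add_le_of_certificate hlam hm htv m'
  have h2 := inner_Phi_le_tvNorm hφ hφ0 m' hp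
  have h3 := h' m
  have h4 := mul_nonneg hlam.le (sub_nonneg.mpr h2)
  have h5 := sq_nonneg ‖Phi Ω φ m' - Phi Ω φ m‖
  have h6 : ‖Phi Ω φ m' - Phi Ω φ m‖ ^ 2 = 0 := by nlinarith
  have h7 : lam * (tvNorm m' - inner ℝ (Phi Ω φ m') p) = 0 := by nlinarith
  refine ⟨?_, ?_⟩
  · rw [hm]
    exact sub_eq_zero.mp (norm_eq_zero.mp (pow_eq_zero_iff two_ne_zero |>.mp h6))
  · rcases mul_eq_zero.mp h7 with h8 | h8
    · exact absurd h8 hlam.ne'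
    · linarith

/-! ### Existence of a sparse solution -/

/-- Away from a neighbourhood of its saturation set, a feasible certificate stays below `1` by a
uniform margin. -/
theorem exists_gap (hφ : ContinuousOn φ Ω)
    (hφ0 : Tendsto (fun x : Ω => φ x) (cocompact Ω) (𝓝 0)) {p : Euc n}
    (hp : p ∈ dualFeasible Ω φ) {N : Set Ω} (hN : IsOpen N)
    (hpN : ∀ x : Ω, |PhiAdj φ p x| = 1 → x ∈ N) :
    ∃ δ, 0 < δ ∧ ∀ x : Ω, x ∉ N → |PhiAdj φ p x| ≤ 1 - δ := by
  have hc : Continuous fun x : Ω => |PhiAdj φ p x| :=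
    ((continuousOn_iff_continuous_domRestrict.mp hφ).inner continuous_const).abs
  have h0 : ∀ᶠ x : Ω in cocompact Ω, |PhiAdj φ p x| < 1 / 2 := by
    have h : Tendsto (fun x : Ω => |PhiAdj φ p x|) (cocompact Ω) (𝓝 0) := by
      have := (hφ0.inner (𝕜 := ℝ) (tendsto_const_nhds (x := p))).abs
      simpa [PhiAdj] using this
    exact h.eventually_lt_const (by norm_num)
  obtain ⟨K, hK, hK1⟩ := mem_cocompact.mp h0
  have hK' : IsCompact (K ∩ Nᶜ) := hK.inter_right hN.isClosed_compl
  rcases (K ∩ Nᶜ).eq_empty_or_nonempty with he | hne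
  · refine ⟨1 / 2, by norm_num, fun x hx => ?_⟩
    have hxK : x ∉ K := fun h => by
      have : x ∈ K ∩ Nᶜ := ⟨h, hx⟩
      rw [he] at this
      exact this
    have : |PhiAdj φ p x| < 1 / 2 := hK1 hxK
    linarith
  · obtain ⟨x₀, hx₀, hmax⟩ := hK'.exists_isMaxOn hne hc.continuousOn
    have h1 : |PhiAdj φ p x₀| < 1 :=
      lt_of_le_of_ne (hp x₀ x₀.2) fun h => hx₀.2 (hpN x₀ h)
    refine ⟨min (1 / 2) (1 - |PhiAdj φ p x₀|), lt_min (by norm_num) (by linarith), fun x hx => ?_⟩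
    by_cases hxK : x ∈ K
    · have : |PhiAdj φ p x| ≤ |PhiAdj φ p x₀| := hmax ⟨hxK, hx⟩
      linarith [min_le_right (1 / 2 : ℝ) (1 - |PhiAdj φ p x₀|)]
    · have : |PhiAdj φ p x| < 1 / 2 := hK1 hxK
      linarith [min_le_left (1 / 2 : ℝ) (1 - |PhiAdj φ p x₀|)]

/-- A direction that strictly decreases `|η|` on the saturation set is a feasible direction. -/
theorem exists_feasible_step (hφ : ContinuousOn φ Ω)
    (hφ0 : Tendsto (fun x : Ω => φ x) (cocompact Ω) (𝓝 0)) {p : Euc n}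
    (hp : p ∈ dualFeasible Ω φ) {w : Euc n}
    (hw : ∀ x ∈ Ω, |PhiAdj φ p x| = 1 → PhiAdj φ p x * PhiAdj φ w x < 0) :
    ∃ t : ℝ, 0 < t ∧ p + t • w ∈ dualFeasible Ω φ := by
  have hc := continuousOn_iff_continuous_domRestrict.mp hφ
  have hcp : ∀ q : Euc n, Continuous fun x : Ω => PhiAdj φ q x := fun q =>
    hc.inner continuous_const
  obtain ⟨δ, hδ, hgap⟩ := exists_gap hφ hφ0 hp
    (N := {x : Ω | PhiAdj φ p x * PhiAdj φ w x < 0})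
    (isOpen_lt ((hcp p).mul (hcp w)) continuous_const) fun x hx => hw x x.2 hx
  obtain ⟨C, hC, hφC⟩ := exists_norm_le hφ hφ0
  have hD : 0 < C * ‖w‖ + 1 := by positivity
  set t := min δ 1 / (C * ‖w‖ + 1) with ht
  have htpos : 0 < t := div_pos (lt_min hδ one_pos) hD
  refine ⟨t, htpos, fun x hx => ?_⟩
  have hg : |t * PhiAdj φ w x| ≤ min δ 1 := by
    rw [abs_mul, abs_of_pos htpos]
    calc t * |PhiAdj φ w x| ≤ t * (C * ‖w‖ + 1) := by
          gcongr
          have := abs_PhiAdj_le φ w x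
          have := mul_le_mul_of_nonneg_right (hφC x hx) (norm_nonneg w)
          linarith
      _ = min δ 1 := div_mul_cancel₀ _ hD.ne'
  rw [PhiAdj_add, PhiAdj_smul]
  have hpx := hp x hx
  by_cases hxN : PhiAdj φ p x * PhiAdj φ w x < 0
  · -- the two summands have opposite signs, and neither exceeds `1` in absolute value
    have hg1 := hg.trans (min_le_right _ _)
    rw [abs_le] at hpx hg1 ⊢
    rcases mul_neg_iff.mp hxN with ⟨h1, h2⟩ | ⟨h1, h2⟩
    · have := mul_neg_of_pos_of_neg htpos h2
      constructor <;> linarith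
    · have := mul_pos htpos h2
      constructor <;> linarith
  · have h1 := hgap ⟨x, hx⟩ hxN
    have h2 := hg.trans (min_le_left _ _)
    exact (abs_add_le _ _).trans (by simpa using add_le_add h1 h2)

theorem inner_nonpos_of_decreasing (hφ : ContinuousOn φ Ω)
    (hφ0 : Tendsto (fun x : Ω => φ x) (cocompact Ω) (𝓝 0)) (hlam : 0 < lam) (y : Euc n)
    {w : Euc n} (hw : ∀ x ∈ extSupport Ω φ lam y, certificate Ω φ lam y x * PhiAdj φ w x < 0) :
    inner ℝ (y - lam • dualSol Ω φ lam y) w ≤ 0 := by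
  obtain ⟨t, ht, hf⟩ := exists_feasible_step hφ hφ0 (dualSol_feasible Ω φ lam y)
    fun x hx h => hw x ⟨hx, h⟩
  have h := dualSol_inner_le hlam y hf
  rw [add_sub_cancel_left, real_inner_smul_right] at h
  by_contra hc
  push Not at hc
  exact absurd h (not_le.mpr (mul_pos ht hc))

theorem certificate_mul_self {y : Euc n} {x : Euc d} (hx : x ∈ extSupport Ω φ lam y) :
    certificate Ω φ lam y x * certificate Ω φ lam y x = 1 := by
  rw [← abs_mul_abs_self, hx.2, one_mul]

theorem inner_certificate_smul {y : Euc n} {x : Euc d} (q : Euc n) :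
    inner ℝ q (certificate Ω φ lam y x • φ x) = certificate Ω φ lam y x * PhiAdj φ q x := by
  rw [real_inner_smul_right, real_inner_comm, PhiAdj]

/-- First order optimality for the projection onto the constraint set: up to a positive factor,
`y - λ p_y` is a convex combination of the active normals `η(x) φ(x)`. -/
theorem residual_mem_cone (hφ : ContinuousOn φ Ω)
    (hφ0 : Tendsto (fun x : Ω => φ x) (cocompact Ω) (𝓝 0)) (hlam : 0 < lam) (y : Euc n)
    (hfin : (extSupport Ω φ lam y).Finite)
    (hne : y - lam • dualSol Ω φ lam y ≠ 0) :
    0 < inner ℝ (y - lam • dualSol Ω φ lam y) (dualSol Ω φ lam y) ∧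
    (inner ℝ (y - lam • dualSol Ω φ lam y) (dualSol Ω φ lam y))⁻¹ •
      (y - lam • dualSol Ω φ lam y) ∈
      convexHull ℝ ((fun x => certificate Ω φ lam y x • φ x) '' extSupport Ω φ lam y) := by
  set p := dualSol Ω φ lam y with hpdef
  set w := y - lam • p with hw
  obtain ⟨C, hC, hφC⟩ := exists_norm_le hφ hφ0
  have hs : 0 < inner ℝ w p := by
    by_contra hs
    push Not at hs
    have h := inner_nonpos_of_decreasing hφ hφ0 hlam y (w := w - (C * ‖w‖ + 1) • p) (by
      intro x hx
      have h1 : PhiAdj φ p x = certificate Ω φ lam y x := rfl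
      rw [PhiAdj_sub, PhiAdj_smul, h1, mul_sub, mul_left_comm, certificate_mul_self hx, mul_one]
      have h2 : certificate Ω φ lam y x * PhiAdj φ w x ≤ C * ‖w‖ := by
        refine (le_abs_self _).trans ?_
        rw [abs_mul, hx.2, one_mul]
        exact (abs_PhiAdj_le φ w x).trans (by gcongr; exact hφC x hx.1)
      linarith)
    rw [← hpdef, ← hw, inner_sub_right, real_inner_smul_right, real_inner_self_eq_norm_sq] at h
    have h1 : 0 < ‖w‖ ^ 2 := by have := norm_pos_iff.mpr hne; positivity
    have h2 : (C * ‖w‖ + 1) * inner ℝ w p ≤ 0 :=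
      mul_nonpos_of_nonneg_of_nonpos (by positivity) hs
    linarith
  refine ⟨hs, ?_⟩
  by_contra hnot
  obtain ⟨f, c, hf1, hf2⟩ := geometric_hahn_banach_closed_point (convex_convexHull ℝ _)
    (Set.Finite.isClosed_convexHull ℝ (hfin.image fun x => certificate Ω φ lam y x • φ x)) hnot
  set z := (InnerProductSpace.toDual ℝ (Euc n)).symm f with hz
  have hzf : ∀ v, inner ℝ z v = f v := fun v => InnerProductSpace.toDual_symm_apply
  have h := inner_nonpos_of_decreasing hφ hφ0 hlam y (w := z - c • p) (by
    intro x hx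
    have h1 : PhiAdj φ p x = certificate Ω φ lam y x := rfl
    rw [PhiAdj_sub, PhiAdj_smul, h1, mul_sub, mul_left_comm, certificate_mul_self hx, mul_one,
      ← inner_certificate_smul, hzf]
    have := hf1 _ (subset_convexHull ℝ _ (mem_image_of_mem _ hx))
    linarith)
  rw [← hpdef, ← hw, inner_sub_right, real_inner_smul_right, real_inner_comm, hzf] at h
  rw [map_smul, smul_eq_mul, inv_mul_eq_div, lt_div_iff₀ hs] at hf2
  linarith

/-- If the extended support is finite, there is a solution carried by points of it at which the
values of `φ` are linearly independent. -/
theorem exists_isInjectiveSolution (hφ : ContinuousOn φ Ω)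
    (hφ0 : Tendsto (fun x : Ω => φ x) (cocompact Ω) (𝓝 0)) (hlam : 0 < lam) (y : Euc n)
    (hfin : (extSupport Ω φ lam y).Finite) :
    ∃ (k : ℕ) (β : Fin k → ℝ) (X : Fin k → Ω), IsInjectiveSolution Ω φ lam y β X ∧
      y - lam • dualSol Ω φ lam y = ∑ j, β j • φ (X j) ∧
      tvNorm (discreteMeasure β X) ≤
        inner ℝ (Phi Ω φ (discreteMeasure β X)) (dualSol Ω φ lam y) := by
  set p := dualSol Ω φ lam y with hpdef
  by_cases hne : y - lam • p = 0
  · have hcert : tvNorm (discreteMeasure (Ω := Ω) (k := 0) ![] (Fin.elim0 ·)) ≤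
        inner ℝ (Phi Ω φ (discreteMeasure (Ω := Ω) (k := 0) ![] (Fin.elim0 ·))) p := by
      rw [Phi_discreteMeasure]
      exact (tvNorm_discreteMeasure_le _ _).trans (by simp)
    refine ⟨0, ![], (Fin.elim0 ·), ⟨?_, ?_, ?_, ?_, ?_⟩, by simp [hne], hcert⟩
    · exact fun i => i.elim0
    · exact fun i => i.elim0
    · exact fun a b _ => Subsingleton.elim _ _
    · exact fun i => i.elim0
    · refine isSolution_of_certificate hφ hφ0 hlam (p := p) ?_ (dualSol_feasible Ω φ lam y) hcert
      rw [Phi_discreteMeasure, hne]; simp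
  · obtain ⟨hs, hmem⟩ := residual_mem_cone hφ hφ0 hlam y hfin hne
    rw [← hpdef] at hs hmem
    set s := inner ℝ (y - lam • p) p with hsdef
    obtain ⟨ι, hι, z, c, hz, haff, hc, hc1, hsum⟩ := eq_pos_convex_span_of_mem_convexHull hmem
    let e := Fintype.equivFin ι
    have hz' : ∀ i, ∃ x ∈ extSupport Ω φ lam y, certificate Ω φ lam y x • φ x = z i :=
      fun i => hz (mem_range_self i)
    choose x hxE hxz using hz'
    set η := fun i => certificate Ω φ lam y (x i) with hη
    have hηη : ∀ i, η i * η i = 1 := fun i => certificate_mul_self (hxE i)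
    have hη0 : ∀ i, η i ≠ 0 := fun i h => by have := hηη i; rw [h] at this; simp at this
    have hφz : ∀ i, φ (x i) = η i • z i := fun i => by
      rw [← hxz i, smul_smul, hηη, one_smul]
    have hzp : ∀ i, inner ℝ (z i) p = 1 := fun i => by
      rw [← hxz i, real_inner_comm, inner_certificate_smul]; exact hηη i
    -- the points `z i` lie on the affine hyperplane `⟨·, p⟩ = 1`, which misses the origin, so
    -- affine independence is linear independence
    have hlin : ∀ a : ι → ℝ, ∑ i, a i • z i = 0 → ∀ i, a i = 0 := by
      intro a ha i
      refine affineIndependent_iff.mp haff Finset.univ a ?_ ha i (Finset.mem_univ i)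
      have := congrArg (fun v => inner ℝ v p) ha
      simpa [sum_inner, real_inner_smul_left, hzp] using this
    set β : Fin (Fintype.card ι) → ℝ := fun j => s * c (e.symm j) * η (e.symm j) with hβ
    set X : Fin (Fintype.card ι) → Ω := fun j => ⟨x (e.symm j), (hxE _).1⟩ with hX
    have hsumX : ∀ a : ι → ℝ, ∑ j, a (e.symm j) • φ (X j) = ∑ i, (a i * η i) • z i := by
      intro a
      rw [← e.symm.sum_comp fun i => (a i * η i) • z i]
      exact Finset.sum_congr rfl fun j _ => by rw [hX, mul_smul, ← hφz]
    have hres : y - lam • p = ∑ j, β j • φ (X j) := by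
      rw [hβ, hsumX fun i => s * c i * η i]
      simp only [mul_assoc, hηη, mul_one]
      simp only [mul_smul]
      rw [← Finset.smul_sum, hsum, smul_inv_smul₀ hs.ne']
    have hcert : tvNorm (discreteMeasure β X) ≤ inner ℝ (Phi Ω φ (discreteMeasure β X)) p := by
      refine (tvNorm_discreteMeasure_le β X).trans ?_
      rw [Phi_discreteMeasure, ← hres, ← hsdef]
      have : ∀ j, |β j| = s * c (e.symm j) := fun j => by
        have h1 : |η (e.symm j)| = 1 := (hxE _).2
        simp only [hβ]
        rw [abs_mul, h1, mul_one, abs_of_pos (mul_pos hs (hc _))]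
      simp only [this]
      rw [e.symm.sum_comp fun i => s * c i, ← Finset.mul_sum, hc1, mul_one]
    refine ⟨Fintype.card ι, β, X, ⟨?_, fun j => hxE _, ?_, ?_, ?_⟩, hres, hcert⟩
    · intro i j hij
      have h1 : x (e.symm i) = x (e.symm j) := congrArg Subtype.val hij
      have h2 : z (e.symm i) = z (e.symm j) := by rw [← hxz, ← hxz, h1]
      exact e.symm.injective (haff.injective h2)
    · intro a b hab
      have h1 : ∑ j, (a - b) j • φ (X j) = 0 := by
        rw [← toLp_PhiMat_mulVec, Matrix.mulVec_sub, sub_eq_zero.mpr hab]; rfl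
      have h2 := hsumX fun i => (a - b) (e i)
      simp only [Equiv.apply_symm_apply, h1] at h2
      funext j
      have h3 := hlin _ h2.symm (e.symm j)
      simp only [Equiv.apply_symm_apply] at h3
      exact sub_eq_zero.mp ((mul_eq_zero.mp h3).resolve_right (hη0 _))
    · exact fun j => mul_ne_zero (mul_pos hs (hc _)).ne' (hη0 _)
    · refine isSolution_of_certificate hφ hφ0 hlam (p := p) ?_ (dualSol_feasible Ω φ lam y) hcert
      rw [Phi_discreteMeasure, hres]

theorem muHat_eq_residual (hφ : ContinuousOn φ Ω)
    (hφ0 : Tendsto (fun x : Ω => φ x) (cocompact Ω) (𝓝 0)) (hlam : 0 < lam) {y : Euc n}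
    (hfin : (extSupport Ω φ lam y).Finite) :
    muHat Ω φ lam y = y - lam • dualSol Ω φ lam y := by
  obtain ⟨k, β, X, hsol, hres, htv⟩ := exists_isInjectiveSolution hφ hφ0 hlam y hfin
  have hex : ∃ m, IsSolution Ω φ lam y m := ⟨_, hsol.2.2.2.2⟩
  rw [muHat, dif_pos hex]
  exact (hex.choose_spec.eq_of_certificate hφ hφ0 hlam (by rw [Phi_discreteMeasure, hres])
    (dualSol_feasible Ω φ lam y) htv).1

/-- An injective solution represents `y - λ p_y`, with amplitudes whose signs are the values of the
certificate. -/
theorem IsInjectiveSolution.residual_and_sign (hφ : ContinuousOn φ Ω)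
    (hφ0 : Tendsto (fun x : Ω => φ x) (cocompact Ω) (𝓝 0)) (hlam : 0 < lam) {y : Euc n}
    (hfin : (extSupport Ω φ lam y).Finite) {k : ℕ} {β : Fin k → ℝ} {X : Fin k → Ω}
    (h : IsInjectiveSolution Ω φ lam y β X) :
    y - lam • dualSol Ω φ lam y = ∑ j, β j • φ (X j) ∧
      ∀ j, 0 < β j * certificate Ω φ lam y (X j) := by
  obtain ⟨k', β', X', hsol, hres, htv⟩ := exists_isInjectiveSolution hφ hφ0 hlam y hfin
  obtain ⟨h1, h2⟩ := h.2.2.2.2.eq_of_certificate hφ hφ0 hlam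
    (by rw [Phi_discreteMeasure, hres]) (dualSol_feasible Ω φ lam y) htv
  rw [Phi_discreteMeasure] at h1 h2
  refine ⟨h1.symm, fun j => ?_⟩
  have h3 := le_tvNorm_discreteMeasure β X h.1
  rw [h2, sum_inner] at h3
  have h4 : ∀ j, inner ℝ (β j • φ (X j)) (dualSol Ω φ lam y) =
      β j * certificate Ω φ lam y (X j) := fun j => real_inner_smul_left _ _ _
  simp only [h4] at h3
  have h5 : ∀ j, β j * certificate Ω φ lam y (X j) ≤ |β j| := fun j => by
    refine (le_abs_self _).trans ?_
    rw [abs_mul, (h.2.1 j).2, mul_one]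
  have h6 : ∀ j, β j * certificate Ω φ lam y (X j) = |β j| := fun j =>
    (Finset.sum_eq_sum_iff_of_le fun j _ => h5 j).mp
      (le_antisymm (Finset.sum_le_sum fun j _ => h5 j) h3) j (Finset.mem_univ j)
  rw [h6]
  exact abs_pos.mpr (h.2.2.2.1 j)

/-! ### Pseudoinverses and the transfer vector -/

theorem pinv_transpose {ι κ : Type*} [Fintype ι] [Fintype κ] (M : Matrix ι κ ℝ) :
    pinv Mᵀ = (pinv M)ᵀ := by
  refine (pinv_spec Mᵀ).unique ?_
  obtain ⟨h1, h2, h3, h4⟩ := pinv_spec M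
  refine ⟨?_, ?_, ?_, ?_⟩
  · rw [← Matrix.transpose_mul, ← Matrix.transpose_mul, ← Matrix.mul_assoc, h1]
  · rw [← Matrix.transpose_mul, ← Matrix.transpose_mul, ← Matrix.mul_assoc, h2]
  · rw [← Matrix.transpose_mul, h4, h4]
  · rw [← Matrix.transpose_mul, h3, h3]

/-- The matrix `M†_{(S,·)} + M_S† M_{Sᶜ} M†_{(Sᶜ,·)}` of the transfer vector. -/
def transferMat {n k : ℕ} (M : Matrix (Fin n) (Fin k) ℝ) (S : Finset (Fin k)) :
    Matrix S (Fin n) ℝ :=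
  (pinv M).submatrix Subtype.val id +
    pinv (M.submatrix id (Subtype.val : S → Fin k)) *
      M.submatrix id (Subtype.val : (Sᶜ : Finset (Fin k)) → Fin k) *
        (pinv M).submatrix Subtype.val id

theorem transferVec_eq {n k : ℕ} (M : Matrix (Fin n) (Fin k) ℝ) (S : Finset (Fin k)) (lam : ℝ)
    (σ : Fin k → ℝ) (y : Euc n) :
    transferVec M S lam σ y =
      transferMat M S *ᵥ ((y : Fin n → ℝ) - pinv Mᵀ *ᵥ (lam • σ)) := rfl

theorem sum_eq_sum_add_sum_compl {k : ℕ} (S : Finset (Fin k)) (F : Fin k → ℝ) :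
    ∑ j, F j = ∑ j : S, F j + ∑ j : (Sᶜ : Finset (Fin k)), F j := by
  rw [Finset.sum_coe_sort S F, Finset.sum_coe_sort Sᶜ F, Finset.sum_add_sum_compl]

/-- No row of the transfer matrix vanishes on the range of `M`, as long as the corresponding column
of `M` is nonzero. If the row `i` vanished, then `M_i = -∑ b_j M_j` over `j ∉ S`, with `b` the row
`i` of `M_S† M_{Sᶜ}`; the diagonal entry `i` of the projection `M_S† M_S` would be `-∑ b_j²`, so
`b = 0` and `M_i = 0`. -/
theorem exists_transferMat_mulVec_ne_zero {n k : ℕ} (M : Matrix (Fin n) (Fin k) ℝ)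
    (S : Finset (Fin k)) (i : S) (hi : ∃ r, M r i ≠ 0) :
    ∃ c : Fin k → ℝ, (transferMat M S *ᵥ (M *ᵥ c)) i ≠ 0 := by
  by_contra hcon
  push Not at hcon
  obtain ⟨hP1, -, -, hP4⟩ := pinv_spec M
  obtain ⟨-, hB2, -, hB4⟩ := pinv_spec (M.submatrix id (Subtype.val : S → Fin k))
  set P := pinv M with hP
  set MS := M.submatrix id (Subtype.val : S → Fin k) with hMS
  set MSc := M.submatrix id (Subtype.val : (Sᶜ : Finset (Fin k)) → Fin k) with hMSc
  set B := pinv MS with hB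
  set b : (Sᶜ : Finset (Fin k)) → ℝ := (B * MSc) i with hb
  let g : Fin k → ℝ := fun j =>
    if h : j ∈ S then (if j = i then 1 else 0) else b ⟨j, Finset.mem_compl.mpr h⟩
  have hgS : ∀ j : S, g j = if j = i then 1 else 0 := fun j => by
    simp only [g, dif_pos j.2, Subtype.ext_iff]
  have hgSc : ∀ j : (Sᶜ : Finset (Fin k)), g j = b j := fun j => by
    have : (j : Fin k) ∉ S := Finset.mem_compl.mp j.2
    simp [g, this]
  have hrow : transferMat M S i = g ᵥ* P := by
    funext r
    have h1 : (g ᵥ* P) r = ∑ j, g j * P j r := rfl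
    rw [h1, sum_eq_sum_add_sum_compl S]
    simp only [hgS, hgSc, ite_mul, one_mul, zero_mul, Finset.sum_ite_eq', Finset.mem_univ, if_true]
    rfl
  have hgPM : g ᵥ* (P * M) = 0 := by
    rw [← Matrix.vecMul_vecMul, ← hrow]
    funext l
    have := hcon (Pi.single l 1)
    rw [Matrix.mulVec_single_one] at this
    exact this
  have hMg : M *ᵥ g = 0 := by
    have h1 : (P * M) *ᵥ g = 0 := by rw [← hP4, Matrix.mulVec_transpose, hgPM]
    rw [← hP1, Matrix.mul_assoc, ← Matrix.mulVec_mulVec, h1, Matrix.mulVec_zero]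
  have hcol : ∀ r, M r i = - (MSc *ᵥ b) r := by
    intro r
    have h1 : ∑ j, M r j * g j = 0 := congrFun hMg r
    rw [sum_eq_sum_add_sum_compl S] at h1
    simp only [hgS, hgSc, mul_ite, mul_one, mul_zero, Finset.sum_ite_eq', Finset.mem_univ,
      if_true] at h1
    have h2 : (MSc *ᵥ b) r = ∑ j : (Sᶜ : Finset (Fin k)), M r j * b j := rfl
    linarith
  have hdiag1 : (B * MS) i i = - ∑ j, b j * b j := by
    have h1 : (B * MS) i i = ∑ r, B i r * M r i := rfl
    have h2 : ∑ j, b j * b j = ∑ r, B i r * (MSc *ᵥ b) r := by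
      have : ∑ j, b j * b j = ((B * MSc) *ᵥ b) i := rfl
      rw [this, ← Matrix.mulVec_mulVec]; rfl
    rw [h1, h2]
    simp only [hcol, mul_neg, Finset.sum_neg_distrib]
  have hdiag2 : (B * MS) i i = ∑ l, (B * MS) i l * (B * MS) i l := by
    have h1 : (B * MS) * (B * MS)ᵀ = B * MS := by
      rw [hB4, ← Matrix.mul_assoc, hB2]
    have h2 : ((B * MS) * (B * MS)ᵀ) i i = ∑ l, (B * MS) i l * (B * MS) i l := rfl
    rw [← h2, h1]
  have hsq : 0 ≤ ∑ l, (B * MS) i l * (B * MS) i l :=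
    Finset.sum_nonneg fun l _ => mul_self_nonneg _
  have hb0 : ∑ j, b j * b j = 0 :=
    le_antisymm (by linarith) (Finset.sum_nonneg fun l _ => mul_self_nonneg _)
  have hb1 : b = 0 := by
    funext j
    exact mul_self_eq_zero.mp
      ((Finset.sum_eq_zero_iff_of_nonneg fun l _ => mul_self_nonneg _).mp hb0 j (Finset.mem_univ j))
  obtain ⟨r, hr⟩ := hi
  exact hr (by rw [hcol r, hb1]; simp)

/-- If the columns in `S` form a basis of the range of `M`, the transfer vector holds the
coefficients in this basis of `y - λ p`, where `Mᵀ p = σ`. -/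
theorem transferVec_apply_eq {n k : ℕ} (M : Matrix (Fin n) (Fin k) ℝ) (S : Finset (Fin k))
    (lam : ℝ) (σ a : Fin k → ℝ) (y p : Euc n)
    (hinj : Function.Injective (M.submatrix id (Subtype.val : S → Fin k)).mulVec)
    (hrange : ∀ c, ∃ b, M *ᵥ c = M.submatrix id (Subtype.val : S → Fin k) *ᵥ b)
    (hσ : Mᵀ *ᵥ (p : Fin n → ℝ) = σ)
    (hres : (y : Fin n → ℝ) - lam • (p : Fin n → ℝ) = M *ᵥ a) (ha : ∀ j, j ∉ S → a j = 0) (i : S) :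
    transferVec M S lam σ y i = a i := by
  obtain ⟨hP1, -, hP3, -⟩ := pinv_spec M
  obtain ⟨hB1, -, -, -⟩ := pinv_spec (M.submatrix id (Subtype.val : S → Fin k))
  rw [transferVec_eq, pinv_transpose, transferMat]
  set P := pinv M with hP
  set MS := M.submatrix id (Subtype.val : S → Fin k) with hMS
  set MSc := M.submatrix id (Subtype.val : (Sᶜ : Finset (Fin k)) → Fin k) with hMSc
  set B := pinv MS with hB
  set v := (y : Fin n → ℝ) - Pᵀ *ᵥ (lam • σ) with hv
  have hsplit : ∀ c : Fin k → ℝ, M *ᵥ c =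
      MS *ᵥ (fun j : S => c j) + MSc *ᵥ (fun j : (Sᶜ : Finset (Fin k)) => c j) := by
    intro c
    funext r
    exact sum_eq_sum_add_sum_compl S fun j => M r j * c j
  have hMPv : M *ᵥ (P *ᵥ v) = M *ᵥ a := by
    have h1 : Pᵀ *ᵥ (lam • σ) = lam • ((M * P) *ᵥ (p : Fin n → ℝ)) := by
      rw [Matrix.mulVec_smul, ← hσ, Matrix.mulVec_mulVec, ← Matrix.transpose_mul, hP3]
    have h2 : M * P * (M * P) = M * P := by rw [← Matrix.mul_assoc, hP1]
    calc M *ᵥ (P *ᵥ v) = (M * P) *ᵥ v := by rw [Matrix.mulVec_mulVec]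
      _ = (M * P) *ᵥ ((y : Fin n → ℝ) - lam • (p : Fin n → ℝ)) := by
          rw [hv, h1, Matrix.mulVec_sub, Matrix.mulVec_sub, Matrix.mulVec_smul, Matrix.mulVec_smul,
            Matrix.mulVec_mulVec, h2]
      _ = M *ᵥ a := by rw [hres, Matrix.mulVec_mulVec, hP1]
  have hMSB : ∀ c, (MS * B) *ᵥ (M *ᵥ c) = M *ᵥ c := by
    intro c
    obtain ⟨b, hb⟩ := hrange c
    rw [hb, Matrix.mulVec_mulVec, hB1]
  have hMSc : ∀ c : (Sᶜ : Finset (Fin k)) → ℝ, (MS * B) *ᵥ (MSc *ᵥ c) = MSc *ᵥ c := by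
    intro c
    have h := hMSB fun j => if h : j ∈ S then 0 else c ⟨j, Finset.mem_compl.mpr h⟩
    rw [hsplit] at h
    have h1 : (fun j : S => (fun j : Fin k =>
        if h : j ∈ S then 0 else c ⟨j, Finset.mem_compl.mpr h⟩) j) = 0 := by
      funext j; simp
    have h2 : (fun j : (Sᶜ : Finset (Fin k)) => (fun j : Fin k =>
        if h : j ∈ S then 0 else c ⟨j, Finset.mem_compl.mpr h⟩) j) = c := by
      funext j
      have : (j : Fin k) ∉ S := Finset.mem_compl.mp j.2
      simp [this]
    rw [h1, h2, Matrix.mulVec_zero, zero_add] at h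
    exact h
  have key : MS *ᵥ ((P.submatrix Subtype.val id + B * MSc * P.submatrix Subtype.val id) *ᵥ v) =
      MS *ᵥ (fun j : S => a j) := by
    have h1 : M *ᵥ a = MS *ᵥ (fun j : S => a j) := by
      rw [hsplit]
      have : (fun j : (Sᶜ : Finset (Fin k)) => a j) = 0 :=
        funext fun j => ha j (Finset.mem_compl.mp j.2)
      rw [this, Matrix.mulVec_zero, add_zero]
    rw [← h1, ← hMPv, hsplit (P *ᵥ v), Matrix.add_mulVec, Matrix.mulVec_add]
    congr 1
    set R : Matrix (Sᶜ : Finset (Fin k)) (Fin n) ℝ := P.submatrix Subtype.val id with hR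
    have h2 : (B * MSc * R) *ᵥ v = B *ᵥ (MSc *ᵥ (R *ᵥ v)) := by
      rw [Matrix.mulVec_mulVec, Matrix.mulVec_mulVec, Matrix.mul_assoc]
    have h3 : MS *ᵥ (B *ᵥ (MSc *ᵥ (R *ᵥ v))) = MSc *ᵥ (R *ᵥ v) := by
      rw [Matrix.mulVec_mulVec, hMSc]
    exact (congrArg (MS *ᵥ ·) h2).trans h3
  exact congrFun (hinj key) i

/-- Small displacements `M c` along the range of `M` can avoid, for all orderings of the columns at
once, the vanishing of an entry of the transfer vector: each ordering excludes the solutions of one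
affine equation, which is not trivial. -/
theorem exists_small_transferVec_ne_zero {n k : ℕ} (M : Matrix (Fin n) (Fin k) ℝ)
    (hM : ∀ j, ∃ r, M r j ≠ 0) (S : Finset (Fin k)) (i : S) (lam : ℝ) (σ : Fin k → ℝ) (y : Euc n)
    {ε : ℝ} (hε : 0 < ε) :
    ∃ c : Fin k → ℝ, ‖c‖ < ε ∧ ∀ π : Equiv.Perm (Fin k),
      transferVec (M.submatrix id π) S lam σ (y + WithLp.toLp 2 (M *ᵥ c)) i ≠ 0 := by
  let f : Equiv.Perm (Fin k) → (Fin k → ℝ) →ₗ[ℝ] ℝ := fun π =>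
    (LinearMap.proj i).comp
      ((transferMat (M.submatrix id π) S).mulVecLin.comp M.mulVecLin)
  have hf : ∀ π, (f π).ker ≠ ⊤ := by
    intro π htop
    obtain ⟨c, hc⟩ := exists_transferMat_mulVec_ne_zero (M.submatrix id π) S i (hM (π i))
    have h1 : M.submatrix id π *ᵥ c = M *ᵥ (c ∘ π.symm) := by
      funext r
      have h2 : (M *ᵥ (c ∘ π.symm)) r = ∑ j, M r j * c (π.symm j) := rfl
      rw [h2, ← Equiv.sum_comp π]
      simp [Matrix.mulVec, dotProduct]
    rw [h1] at hc
    have : c ∘ π.symm ∈ (f π).ker := by rw [htop]; trivial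
    exact hc (LinearMap.mem_ker.mp this)
  have hcov : ⋃ π, ((f π).ker : Set (Fin k → ℝ)) ≠ Set.univ := fun h => by
    obtain ⟨π, hπ⟩ := Subspace.exists_eq_top_of_iUnion_eq_univ h
    exact hf π hπ
  obtain ⟨c₀, hc₀⟩ := (Set.ne_univ_iff_exists_notMem _).mp hcov
  have hc₀' : ∀ π, f π c₀ ≠ 0 := by
    intro π h
    exact hc₀ (Set.mem_iUnion.mpr ⟨π, LinearMap.mem_ker.mpr h⟩)
  have haff : ∀ (π : Equiv.Perm (Fin k)) (t : ℝ),
      transferVec (M.submatrix id π) S lam σ (y + WithLp.toLp 2 (M *ᵥ (t • c₀))) i =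
        transferVec (M.submatrix id π) S lam σ y i + t * f π c₀ := by
    intro π t
    rw [transferVec_eq, transferVec_eq]
    have h1 : ((y + WithLp.toLp 2 (M *ᵥ (t • c₀)) : Euc n) : Fin n → ℝ) -
        pinv (M.submatrix id π)ᵀ *ᵥ (lam • σ) =
        ((y : Fin n → ℝ) - pinv (M.submatrix id π)ᵀ *ᵥ (lam • σ)) + t • (M *ᵥ c₀) := by
      rw [WithLp.ofLp_add, Matrix.mulVec_smul]
      abel
    rw [h1, Matrix.mulVec_add, Matrix.mulVec_smul _ t]
    rfl
  obtain ⟨t, ht, htn⟩ := (Set.Ioo_infinite (show (0 : ℝ) < ε / (‖c₀‖ + 1) by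
    positivity)).exists_notMem_finite (Set.finite_range fun π : Equiv.Perm (Fin k) => -(transferVec (M.submatrix id π) S lam σ y i) / f π c₀)
  refine ⟨t • c₀, ?_, fun π h => ?_⟩
  · rw [norm_smul, Real.norm_of_nonneg ht.1.le]
    have h1 := (lt_div_iff₀ (by positivity)).mp ht.2
    nlinarith [ht.1]
  · rw [haff] at h
    refine htn ⟨π, ?_⟩
    simp only
    rw [div_eq_iff (hc₀' π)]
    linarith

/-! ### Local analysis near a saturation point -/

theorem hasFDerivAt_PhiAdj {x : Euc d} (hx : DifferentiableAt ℝ φ x) (p : Euc n) :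
    HasFDerivAt (PhiAdj φ p) ((innerSL ℝ p).comp (fderiv ℝ φ x)) x := by
  have h := (innerSL ℝ p).hasFDerivAt.comp x hx.hasFDerivAt
  have e : (innerSL ℝ p) ∘ φ = PhiAdj φ p := by
    funext z
    simp [PhiAdj, real_inner_comm]
  rwa [e] at h

theorem hessian_PhiAdj {x : Euc d} (hx : ContDiffAt ℝ 2 φ x) (p : Euc n) (i j : Fin d) :
    hessian (PhiAdj φ p) x i j =
      inner ℝ (fderiv ℝ (fderiv ℝ φ) x (EuclideanSpace.single i 1) (EuclideanSpace.single j 1))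
        p := by
  have h1 : fderiv ℝ (PhiAdj φ p) =ᶠ[𝓝 x] fun z => (innerSL ℝ p).comp (fderiv ℝ φ z) := by
    filter_upwards [hx.eventually (by simp)] with z hz
    exact (hasFDerivAt_PhiAdj (hz.differentiableAt (by simp)) p).fderiv
  have h2 : DifferentiableAt ℝ (fderiv ℝ φ) x :=
    (hx.fderiv_right (m := 1) (by norm_num)).differentiableAt (by simp)
  have h3 : HasFDerivAt (fun z => (innerSL ℝ p).comp (fderiv ℝ φ z)) _ x :=
    ((ContinuousLinearMap.compL ℝ (Euc d) (Euc n) ℝ (innerSL ℝ p)).hasFDerivAt).comp x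
      h2.hasFDerivAt
  rw [hessian, Matrix.of_apply, iteratedFDeriv_two_apply, h1.fderiv_eq, h3.fderiv]
  simp [real_inner_comm]

theorem dotProduct_hessian_mulVec {x : Euc d} (hx : ContDiffAt ℝ 2 φ x) (p : Euc n)
    (v w : Euc d) :
    (v : Fin d → ℝ) ⬝ᵥ (hessian (PhiAdj φ p) x *ᵥ (w : Fin d → ℝ)) =
      inner ℝ (fderiv ℝ (fderiv ℝ φ) x v w) p := by
  have hv : ∀ v : Euc d, v = ∑ i, v i • EuclideanSpace.single i (1 : ℝ) := fun v => by
    ext i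
    simp [Pi.single_apply]
  conv_rhs => rw [hv v, hv w]
  simp only [map_sum, map_smul, _root_.sum_apply, _root_.smul_apply,
    sum_inner, real_inner_smul_left, ← hessian_PhiAdj hx, Finset.smul_sum]
  simp only [Matrix.mulVec, dotProduct, Finset.mul_sum]
  rw [Finset.sum_comm]
  exact Finset.sum_congr rfl fun i _ => Finset.sum_congr rfl fun j _ => by ring

/-- Assumption (A1) in terms of the second derivative of `φ`. -/
theorem inner_fderiv_fderiv_neg {x : Euc d} (hx : ContDiffAt ℝ 2 φ x) {p : Euc n}
    (hH : (-(PhiAdj φ p x • hessian (PhiAdj φ p) x)).PosDef) {v : Euc d} (hv : v ≠ 0) :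
    PhiAdj φ p x * inner ℝ (fderiv ℝ (fderiv ℝ φ) x v v) p < 0 := by
  have hv' : (v : Fin d → ℝ) ≠ 0 := fun h => hv (by ext i; exact congrFun h i)
  have h := hH.dotProduct_mulVec_pos hv'
  simp only [star_trivial, Matrix.neg_mulVec, Matrix.smul_mulVec, dotProduct_neg,
    dotProduct_smul, smul_eq_mul] at h
  rw [dotProduct_hessian_mulVec hx] at h
  linarith

/-- A negative definite quadratic form is bounded above by `-μ ‖v‖²`. -/
theorem exists_neg_bound {D : Euc d →L[ℝ] Euc d →L[ℝ] ℝ} (hD : ∀ v, v ≠ 0 → D v v < 0) :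
    ∃ μ, 0 < μ ∧ ∀ v, D v v ≤ -μ * ‖v‖ ^ 2 := by
  have hc : Continuous fun v : Euc d => D v v := D.continuous.clm_apply continuous_id
  rcases (Metric.sphere (0 : Euc d) 1).eq_empty_or_nonempty with he | hne
  · refine ⟨1, one_pos, fun v => ?_⟩
    by_cases hv : v = 0
    · simp [hv]
    · have : ‖v‖⁻¹ • v ∈ Metric.sphere (0 : Euc d) 1 := by
        rw [mem_sphere_zero_iff_norm, norm_smul, norm_inv, norm_norm,
          inv_mul_cancel₀ (norm_ne_zero_iff.mpr hv)]
      rw [he] at this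
      exact this.elim
  · obtain ⟨u, hu, hmax⟩ := (isCompact_sphere (0 : Euc d) 1).exists_isMaxOn hne hc.continuousOn
    have hu0 : u ≠ 0 := fun h => by rw [h] at hu; simp at hu
    refine ⟨-(D u u), neg_pos.mpr (hD u hu0), fun v => ?_⟩
    by_cases hv : v = 0
    · simp [hv]
    · have hv0 := norm_ne_zero_iff.mpr hv
      have hs : ‖v‖⁻¹ • v ∈ Metric.sphere (0 : Euc d) 1 := by
        rw [mem_sphere_zero_iff_norm, norm_smul, norm_inv, norm_norm, inv_mul_cancel₀ hv0]
      have h : D (‖v‖⁻¹ • v) (‖v‖⁻¹ • v) ≤ D u u := hmax hs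
      simp only [map_smul, _root_.smul_apply, smul_eq_mul] at h
      have h2 : 0 < ‖v‖ ^ 2 := by positivity
      calc D v v = ‖v‖ ^ 2 * (‖v‖⁻¹ * (‖v‖⁻¹ * D v v)) := by field_simp
        _ ≤ ‖v‖ ^ 2 * D u u := by gcongr
        _ = _ := by ring

/-- Points of `Ω` where `|Φ^* p|` attains the bound `1` are critical points of `Φ^* p`. -/
theorem inner_fderiv_eq_zero {p : Euc n} (hp : p ∈ dualFeasible Ω φ) {x : Euc d}
    (hx : x ∈ interior Ω) (hd : DifferentiableAt ℝ φ x) (h1 : |PhiAdj φ p x| = 1) (v : Euc d) :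
    inner ℝ (fderiv ℝ φ x v) p = 0 := by
  have hnear : ∀ᶠ z in 𝓝 x, |PhiAdj φ p z| ≤ 1 := by
    filter_upwards [mem_interior_iff_mem_nhds.mp hx] with z hz using hp z hz
  have h0 : fderiv ℝ (PhiAdj φ p) x = 0 := by
    rcases (abs_eq one_pos.le).mp h1 with h | h
    · have : IsLocalMax (PhiAdj φ p) x := by
        filter_upwards [hnear] with z hz
        rw [h]
        exact (abs_le.mp hz).2
      exact this.fderiv_eq_zero
    · have : IsLocalMin (PhiAdj φ p) x := by
        filter_upwards [hnear] with z hz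
        rw [h]
        exact (abs_le.mp hz).1
      exact this.fderiv_eq_zero
  rw [(hasFDerivAt_PhiAdj hd p).fderiv] at h0
  have := DFunLike.congr_fun h0 v
  rw [real_inner_comm]
  simpa using this

/-- Quantitative control near a saturation point `x` of `p`, on balls of radius `C⁻¹` around `x` and
`p`: critical points of `Φ^* p'` depend on `p'` in a Lipschitz way (in particular there is at most
one for each `p'`), the sign of `Φ^* p'` is constant, and `φ` is Lipschitz. The condition weakens as
`C` grows. -/
structure IsControlled (Ω : Set (Euc d)) (φ : Euc d → Euc n) (p : Euc n) (x : Euc d) (C : ℝ) :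
    Prop where
  subset : ∀ x', ‖x' - x‖ < C⁻¹ → x' ∈ interior Ω ∧ DifferentiableAt ℝ φ x'
  crit : ∀ p' p'', ‖p' - p‖ < C⁻¹ → ‖p'' - p‖ < C⁻¹ → ∀ x' x'', ‖x' - x‖ < C⁻¹ →
    ‖x'' - x‖ < C⁻¹ → (∀ v, inner ℝ (fderiv ℝ φ x' v) p' = 0) →
    (∀ v, inner ℝ (fderiv ℝ φ x'' v) p'' = 0) → ‖x' - x''‖ ≤ C * ‖p' - p''‖
  sign : ∀ p', ‖p' - p‖ < C⁻¹ → ∀ x', ‖x' - x‖ < C⁻¹ → 0 < PhiAdj φ p x * PhiAdj φ p' x'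
  lip : ∀ x' x'', ‖x' - x‖ < C⁻¹ → ‖x'' - x‖ < C⁻¹ → ‖φ x' - φ x''‖ ≤ C * ‖x' - x''‖

theorem IsControlled.mono {p : Euc n} {x : Euc d} {C C' : ℝ} (hC : 0 < C)
    (h : IsControlled Ω φ p x C) (hCC : C ≤ C') : IsControlled Ω φ p x C' := by
  have hi : C'⁻¹ ≤ C⁻¹ := inv_anti₀ hC hCC
  constructor
  · exact fun x' hx' => h.subset x' (hx'.trans_le hi)
  · intro p' p'' hp' hp'' x' x'' hx' hx'' h1 h2
    exact (h.crit p' p'' (hp'.trans_le hi) (hp''.trans_le hi) x' x'' (hx'.trans_le hi)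
      (hx''.trans_le hi) h1 h2).trans (by gcongr)
  · exact fun p' hp' x' hx' => h.sign p' (hp'.trans_le hi) x' (hx'.trans_le hi)
  · exact fun x' x'' hx' hx'' => (h.lip x' x'' (hx'.trans_le hi) (hx''.trans_le hi)).trans
      (by gcongr)

/-- Strict differentiability of the derivative of `φ` together with a negative definite Hessian
makes the critical point a Lipschitz function of `p'`. -/
theorem exists_crit_lipschitz {p : Euc n} {x : Euc d} (hx : ContDiffAt ℝ 2 φ x)
    (h1 : |PhiAdj φ p x| = 1) (hH : (-(PhiAdj φ p x • hessian (PhiAdj φ p) x)).PosDef) :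
    ∃ r K, 0 < r ∧ 0 < K ∧ ∀ p' p'', ‖p' - p‖ < r → ‖p'' - p‖ < r → ∀ x' x'', ‖x' - x‖ < r →
      ‖x'' - x‖ < r → (∀ v, inner ℝ (fderiv ℝ φ x' v) p' = 0) →
      (∀ v, inner ℝ (fderiv ℝ φ x'' v) p'' = 0) → ‖x' - x''‖ ≤ K * ‖p' - p''‖ := by
  set η := PhiAdj φ p x with hη
  have hf1 : ContDiffAt ℝ 1 (fderiv ℝ φ) x := hx.fderiv_right (by norm_num)
  set D := fderiv ℝ (fderiv ℝ φ) x with hDdef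
  have hstrict : HasStrictFDerivAt (fderiv ℝ φ) D x := hf1.hasStrictFDerivAt (by simp)
  obtain ⟨μ, hμ, hμD⟩ := exists_neg_bound
    (D := η • (ContinuousLinearMap.compL ℝ (Euc d) (Euc n) ℝ (innerSL ℝ p)).comp D) (by
      intro v hv
      have := inner_fderiv_fderiv_neg hx hH hv
      simpa [real_inner_comm] using this)
  have hμD' : ∀ v, η * inner ℝ (D v v) p ≤ -μ * ‖v‖ ^ 2 := fun v => by
    have := hμD v
    simpa [real_inner_comm] using this
  set ε := μ / (4 * (‖p‖ + 1)) with hε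
  have hεpos : 0 < ε := by positivity
  have hev := hstrict.isLittleO.def hεpos
  obtain ⟨r₁, hr₁, hball⟩ := Metric.eventually_nhds_iff.mp hev
  obtain ⟨r₂, hr₂, hbd⟩ := Metric.eventually_nhds_iff.mp
    (hf1.continuousAt.norm.eventually_lt_const (lt_add_one ‖fderiv ℝ φ x‖))
  set L := ‖fderiv ℝ φ x‖ + 1 with hL
  have hLpos : 0 < L := by positivity
  set r := min (min r₁ r₂) (min 1 (μ / (4 * (‖D‖ + 1)))) with hr
  have hrpos : 0 < r := lt_min (lt_min hr₁ hr₂) (lt_min one_pos (by positivity))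
  have hrr₁ : r ≤ r₁ := (min_le_left _ _).trans (min_le_left _ _)
  have hrr₂ : r ≤ r₂ := (min_le_left _ _).trans (min_le_right _ _)
  have hr1 : r ≤ 1 := (min_le_right _ _).trans (min_le_left _ _)
  have hrD : r ≤ μ / (4 * (‖D‖ + 1)) := (min_le_right _ _).trans (min_le_right _ _)
  refine ⟨r, 2 * L / μ, hrpos, by positivity, ?_⟩
  intro p' p'' hp' hp'' x' x'' hx' hx'' hc' hc''
  set v := x' - x'' with hv
  have e1 : ‖(fderiv ℝ φ x' - fderiv ℝ φ x'') v - D v v‖ ≤ ε * ‖v‖ ^ 2 := by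
    have h := hball (y := (x', x'')) (by
      rw [Prod.dist_eq, max_lt_iff, dist_eq_norm, dist_eq_norm]
      exact ⟨hx'.trans_le hrr₁, hx''.trans_le hrr₁⟩)
    have h2 := (fderiv ℝ φ x' - fderiv ℝ φ x'' - D v).le_of_opNorm_le h v
    rw [_root_.sub_apply] at h2
    calc _ ≤ _ := h2
      _ = ε * ‖v‖ ^ 2 := by rw [← hv]; ring
  have e2 : |inner ℝ (fderiv ℝ φ x'' v) (p' - p'')| ≤ L * ‖v‖ * ‖p' - p''‖ := by
    refine (abs_real_inner_le_norm _ _).trans ?_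
    gcongr
    refine (ContinuousLinearMap.le_opNorm _ _).trans ?_
    gcongr
    exact (hbd (by rw [dist_eq_norm]; exact hx''.trans_le hrr₂)).le
  have e3 : inner ℝ ((fderiv ℝ φ x' - fderiv ℝ φ x'') v) p' =
      - inner ℝ (fderiv ℝ φ x'' v) (p' - p'') := by
    rw [_root_.sub_apply, inner_sub_left, inner_sub_right, hc', hc'']
    ring
  have e4 : |inner ℝ ((fderiv ℝ φ x' - fderiv ℝ φ x'') v - D v v) p'| ≤ μ / 4 * ‖v‖ ^ 2 := by
    refine (abs_real_inner_le_norm _ _).trans ?_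
    have hp'n : ‖p'‖ ≤ ‖p‖ + 1 := by
      have := norm_add_le p (p' - p)
      rw [add_sub_cancel] at this
      linarith
    calc _ ≤ (ε * ‖v‖ ^ 2) * (‖p‖ + 1) := by gcongr
      _ = μ / 4 * ‖v‖ ^ 2 := by rw [hε]; field_simp
  have e5 : |inner ℝ (D v v) (p' - p)| ≤ μ / 4 * ‖v‖ ^ 2 := by
    refine (abs_real_inner_le_norm _ _).trans ?_
    calc _ ≤ (‖D‖ * ‖v‖ * ‖v‖) * r := by
          gcongr
          exact D.le_opNorm₂ v v
      _ ≤ ((‖D‖ + 1) * ‖v‖ * ‖v‖) * (μ / (4 * (‖D‖ + 1))) := by gcongr; linarith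
      _ = μ / 4 * ‖v‖ ^ 2 := by field_simp
  have e6 : η * inner ℝ (D v v) p = η * (-inner ℝ (fderiv ℝ φ x'' v) (p' - p'')
      - inner ℝ ((fderiv ℝ φ x' - fderiv ℝ φ x'') v - D v v) p'
      - inner ℝ (D v v) (p' - p)) := by
    rw [← e3, inner_sub_left _ (D v v), inner_sub_right (D v v)]
    ring
  have e7 : μ * ‖v‖ ^ 2 ≤ L * ‖v‖ * ‖p' - p''‖ + μ / 4 * ‖v‖ ^ 2 + μ / 4 * ‖v‖ ^ 2 := by
    have h2 := hμD' v
    have h3 : -(η * inner ℝ (D v v) p) ≤ |(-inner ℝ (fderiv ℝ φ x'' v) (p' - p'')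
      - inner ℝ ((fderiv ℝ φ x' - fderiv ℝ φ x'') v - D v v) p'
      - inner ℝ (D v v) (p' - p))| := by
      rw [e6]
      refine (neg_le_abs _).trans ?_
      rw [abs_mul, h1, one_mul]
    have h4 := abs_sub (-inner ℝ (fderiv ℝ φ x'' v) (p' - p'')
      - inner ℝ ((fderiv ℝ φ x' - fderiv ℝ φ x'') v - D v v) p') (inner ℝ (D v v) (p' - p))
    have h5 := abs_sub (-inner ℝ (fderiv ℝ φ x'' v) (p' - p''))
      (inner ℝ ((fderiv ℝ φ x' - fderiv ℝ φ x'') v - D v v) p')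
    rw [abs_neg] at h5
    linarith
  rcases (norm_nonneg v).eq_or_lt with h0 | h0
  · rw [← h0]; positivity
  · have e8 : ‖v‖ * (μ / 2 * ‖v‖) ≤ ‖v‖ * (L * ‖p' - p''‖) := by linarith
    have e9 := le_of_mul_le_mul_left e8 h0
    rw [div_mul_eq_mul_div, le_div_iff₀ hμ]
    linarith

theorem exists_isControlled {p : Euc n} {x : Euc d} (hxΩ : x ∈ interior Ω)
    (hx : ContDiffAt ℝ 2 φ x) (h1 : |PhiAdj φ p x| = 1)
    (hH : (-(PhiAdj φ p x • hessian (PhiAdj φ p) x)).PosDef) :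
    ∃ C, 0 < C ∧ IsControlled Ω φ p x C := by
  obtain ⟨r₁, K, hr₁, hK, hcrit⟩ := exists_crit_lipschitz hx h1 hH
  obtain ⟨K', t, ht, hlip⟩ := (hx.of_le (by norm_num : (1 : WithTop ℕ∞) ≤ 2)).exists_lipschitzOnWith
  have hsub : ∀ᶠ z in 𝓝 x, z ∈ interior Ω ∧ DifferentiableAt ℝ φ z ∧ z ∈ t := by
    filter_upwards [isOpen_interior.mem_nhds hxΩ, hx.eventually (by simp), ht] with z h1 h2 h3
    exact ⟨h1, h2.differentiableAt (by simp), h3⟩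
  obtain ⟨r₂, hr₂, hsub⟩ := Metric.eventually_nhds_iff.mp hsub
  have hcont : ContinuousAt (fun z : Euc n × Euc d => PhiAdj φ p x * PhiAdj φ z.1 z.2) (p, x) := by
    have h3 : ContinuousAt (fun z : Euc n × Euc d => φ z.2) (p, x) :=
      ContinuousAt.comp (f := Prod.snd) (g := φ) (x := (p, x)) hx.continuousAt continuousAt_snd
    exact continuousAt_const.mul (h3.inner continuousAt_fst)
  have hpos : 0 < PhiAdj φ p x * PhiAdj φ p x := by
    rw [← abs_mul_abs_self, h1]; norm_num
  obtain ⟨r₃, hr₃, hsign⟩ := Metric.eventually_nhds_iff.mp (hcont.eventually_const_lt hpos)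
  set r := min r₁ (min r₂ r₃) with hr
  have hrpos : 0 < r := lt_min hr₁ (lt_min hr₂ hr₃)
  set C := max r⁻¹ (max K K') with hC
  have hCpos : 0 < C := lt_max_of_lt_left (inv_pos.mpr hrpos)
  have hCr : C⁻¹ ≤ r := by
    rw [inv_le_comm₀ hCpos hrpos]
    exact le_max_left _ _
  have hC1 : C⁻¹ ≤ r₁ := hCr.trans (min_le_left _ _)
  have hC2 : C⁻¹ ≤ r₂ := hCr.trans ((min_le_right _ _).trans (min_le_left _ _))
  have hC3 : C⁻¹ ≤ r₃ := hCr.trans ((min_le_right _ _).trans (min_le_right _ _))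
  refine ⟨C, hCpos, ?_, ?_, ?_, ?_⟩
  · intro x' hx'
    have := hsub (y := x') (by rw [dist_eq_norm]; exact hx'.trans_le hC2)
    exact ⟨this.1, this.2.1⟩
  · intro p' p'' hp' hp'' x' x'' hx' hx'' hc' hc''
    refine (hcrit p' p'' (hp'.trans_le hC1) (hp''.trans_le hC1) x' x'' (hx'.trans_le hC1)
      (hx''.trans_le hC1) hc' hc'').trans ?_
    gcongr
    exact (le_max_left _ _).trans (le_max_right _ _)
  · intro p' hp' x' hx'
    exact hsign (y := (p', x')) (by
      rw [Prod.dist_eq, max_lt_iff, dist_eq_norm, dist_eq_norm]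
      exact ⟨hp'.trans_le hC3, hx'.trans_le hC3⟩)
  · intro x' x'' hx' hx''
    have h2 := (hsub (y := x') (by rw [dist_eq_norm]; exact hx'.trans_le hC2)).2.2
    have h3 := (hsub (y := x'') (by rw [dist_eq_norm]; exact hx''.trans_le hC2)).2.2
    have := hlip.dist_le_mul x' h2 x'' h3
    rw [dist_eq_norm, dist_eq_norm] at this
    refine this.trans ?_
    gcongr
    exact (le_max_right _ _).trans (le_max_right _ _)

/-! ### Stability of the extended support -/

theorem exists_uniform_control {y : Euc n}
    (hreg : ∀ x ∈ extSupport Ω φ lam y, x ∈ interior Ω ∧ ContDiffAt ℝ 2 φ x)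
    (hA1 : AssumptionA1 Ω φ lam y) :
    ∃ C, 0 < C ∧ ∀ x ∈ extSupport Ω φ lam y, IsControlled Ω φ (dualSol Ω φ lam y) x C := by
  have h : ∀ x ∈ extSupport Ω φ lam y, ∃ C, 0 < C ∧ IsControlled Ω φ (dualSol Ω φ lam y) x C :=
    fun x hx => exists_isControlled (hreg x hx).1 (hreg x hx).2 hx.2 (hA1.2 x hx)
  choose! c hc hcx using h
  have hnn : ∀ x ∈ hA1.1.toFinset, 0 ≤ c x := fun x hx => (hc x (hA1.1.mem_toFinset.mp hx)).le
  refine ⟨∑ x ∈ hA1.1.toFinset, c x + 1, add_pos_of_nonneg_of_pos (Finset.sum_nonneg hnn) one_pos,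
    fun x hx => (hcx x hx).mono (hc x hx) ?_⟩
  exact (Finset.single_le_sum hnn (hA1.1.mem_toFinset.mpr hx)).trans (by linarith)

/-- For `y'` near `y`, the dual solution and the extended support are close to those of `y`. -/
theorem eventually_extSupport_near (hφ : ContinuousOn φ Ω)
    (hφ0 : Tendsto (fun x : Ω => φ x) (cocompact Ω) (𝓝 0)) (hlam : 0 < lam) (y : Euc n)
    {r : ℝ} (hr : 0 < r) :
    ∀ᶠ y' in 𝓝 y, ‖dualSol Ω φ lam y' - dualSol Ω φ lam y‖ < r ∧
      ∀ x' ∈ extSupport Ω φ lam y', ∃ x ∈ extSupport Ω φ lam y, ‖x' - x‖ < r := by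
  obtain ⟨δ, hδ, hgap⟩ := exists_gap hφ hφ0 (dualSol_feasible Ω φ lam y)
    (N := {z : Ω | ∃ x ∈ extSupport Ω φ lam y, ‖(z : Euc d) - x‖ < r}) (by
      have : {z : Ω | ∃ x ∈ extSupport Ω φ lam y, ‖(z : Euc d) - x‖ < r} =
          ⋃ x ∈ extSupport Ω φ lam y, {z : Ω | ‖(z : Euc d) - x‖ < r} := by ext z; simp
      rw [this]
      refine isOpen_biUnion fun x _ => isOpen_lt ?_ continuous_const
      fun_prop) fun x hx => ⟨x, ⟨x.2, hx⟩, by simpa using hr⟩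
  obtain ⟨B, hB, hφB⟩ := exists_norm_le hφ hφ0
  have hε : 0 < lam * min r (δ / B) := mul_pos hlam (lt_min hr (div_pos hδ hB))
  filter_upwards [Metric.ball_mem_nhds y hε] with y' hy'
  rw [Metric.mem_ball, dist_eq_norm] at hy'
  have hlip := dualSol_lipschitz (Ω := Ω) (φ := φ) hlam y y'
  have hq : ‖dualSol Ω φ lam y' - dualSol Ω φ lam y‖ < min r (δ / B) :=
    lt_of_mul_lt_mul_left (hlip.trans_lt hy') hlam.le
  refine ⟨hq.trans_le (min_le_left _ _), fun x' hx' => ?_⟩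
  by_contra hnot
  have h1 := hgap ⟨x', hx'.1⟩ hnot
  have h2 : |PhiAdj φ (dualSol Ω φ lam y' - dualSol Ω φ lam y) x'| < δ := by
    calc _ ≤ ‖φ x'‖ * ‖dualSol Ω φ lam y' - dualSol Ω φ lam y‖ := abs_PhiAdj_le _ _ _
      _ ≤ B * ‖dualSol Ω φ lam y' - dualSol Ω φ lam y‖ := by gcongr; exact hφB x' hx'.1
      _ < δ := by
        have := hq.trans_le (min_le_right _ _)
        rw [lt_div_iff₀ hB] at this
        linarith
  have h3 : |PhiAdj φ (dualSol Ω φ lam y') x'| = 1 := hx'.2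
  rw [PhiAdj_sub] at h2
  have h4 := abs_sub_abs_le_abs_sub (PhiAdj φ (dualSol Ω φ lam y') x')
    (PhiAdj φ (dualSol Ω φ lam y) x')
  rw [h3] at h4
  simp only at h1
  linarith

theorem IsControlled.inner_fderiv_eq_zero {p : Euc n} {x : Euc d} {C : ℝ}
    (h : IsControlled Ω φ p x C) {y' : Euc n} {x' : Euc d} (hx' : x' ∈ extSupport Ω φ lam y')
    (hxx' : ‖x' - x‖ < C⁻¹) (v : Euc d) :
    inner ℝ (fderiv ℝ φ x' v) (dualSol Ω φ lam y') = 0 :=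
  Blasso.inner_fderiv_eq_zero (dualSol_feasible Ω φ lam y') (h.subset x' hxx').1
    (h.subset x' hxx').2 hx'.2 v

theorem IsControlled.extSupport_unique {y y' : Euc n} {x : Euc d} {C : ℝ}
    (h : IsControlled Ω φ (dualSol Ω φ lam y) x C)
    (hy' : ‖dualSol Ω φ lam y' - dualSol Ω φ lam y‖ < C⁻¹) {x' x'' : Euc d}
    (hx' : x' ∈ extSupport Ω φ lam y') (hx'' : x'' ∈ extSupport Ω φ lam y')
    (hxx' : ‖x' - x‖ < C⁻¹) (hxx'' : ‖x'' - x‖ < C⁻¹) : x' = x'' := by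
  have := h.crit _ _ hy' hy' x' x'' hxx' hxx'' (h.inner_fderiv_eq_zero hx' hxx')
    (h.inner_fderiv_eq_zero hx'' hxx'')
  rw [sub_self, norm_zero, mul_zero] at this
  exact sub_eq_zero.mp (norm_le_zero_iff.mp this)

theorem eventually_extSupport_finite (hφ : ContinuousOn φ Ω)
    (hφ0 : Tendsto (fun x : Ω => φ x) (cocompact Ω) (𝓝 0)) (hlam : 0 < lam) {y : Euc n}
    (hfin : (extSupport Ω φ lam y).Finite) {C : ℝ} (hC : 0 < C)
    (hctrl : ∀ x ∈ extSupport Ω φ lam y, IsControlled Ω φ (dualSol Ω φ lam y) x C) :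
    ∀ᶠ y' in 𝓝 y, (extSupport Ω φ lam y').Finite := by
  filter_upwards [eventually_extSupport_near hφ hφ0 hlam y (inv_pos.mpr hC)] with y' hy'
  obtain ⟨hq, hnear⟩ := hy'
  choose! f hf hfx using hnear
  refine Set.Finite.of_injOn (f := f) (fun x hx => hf x hx) (fun x hx x' hx' hxx => ?_) hfin
  refine (hctrl _ (hf x hx)).extSupport_unique hq hx hx' (hfx x hx) ?_
  rw [hxx]
  exact hfx x' hx'

/-- If the extended support at a nearby `y'` has at least as many points as the one at `y`, then its
points match those at `y` one to one. -/
theorem exists_matching {y y' : Euc n} {C : ℝ} (hC : 0 < C)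
    (hctrl : ∀ x ∈ extSupport Ω φ lam y, IsControlled Ω φ (dualSol Ω φ lam y) x C)
    (hq : ‖dualSol Ω φ lam y' - dualSol Ω φ lam y‖ < C⁻¹)
    (hnear : ∀ x' ∈ extSupport Ω φ lam y', ∃ x ∈ extSupport Ω φ lam y, ‖x' - x‖ < C⁻¹)
    {K : ℕ} {E E' : Fin K → Ω} (hEmem : ∀ j, (E j : Euc d) ∈ extSupport Ω φ lam y)
    (hEcov : ∀ x ∈ extSupport Ω φ lam y, ∃ j, (E j : Euc d) = x)
    (hE' : Function.Injective E') (hE'mem : ∀ j, (E' j : Euc d) ∈ extSupport Ω φ lam y') :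
    ∃ π : Equiv.Perm (Fin K), ∀ j, ‖(E' (π j) : Euc d) - E j‖ < C⁻¹ ∧
      ‖(E' (π j) : Euc d) - E j‖ ≤ C * ‖dualSol Ω φ lam y' - dualSol Ω φ lam y‖ := by
  have h : ∀ j, ∃ l, ‖(E' j : Euc d) - E l‖ < C⁻¹ := fun j => by
    obtain ⟨x, hx, hxx⟩ := hnear _ (hE'mem j)
    obtain ⟨l, rfl⟩ := hEcov x hx
    exact ⟨l, hxx⟩
  choose f hf using h
  have hinj : Function.Injective f := fun i j hij => by
    refine hE' (Subtype.ext ((hctrl _ (hEmem (f i))).extSupport_unique hq (hE'mem i) (hE'mem j)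
      (hf i) ?_))
    rw [hij]
    exact hf j
  let e := Equiv.ofBijective f (Finite.injective_iff_bijective.mp hinj)
  have hcl : ∀ j, ‖(E' (e.symm j) : Euc d) - E j‖ < C⁻¹ := fun j => by
    have h1 := hf (e.symm j)
    have h2 : f (e.symm j) = j := e.apply_symm_apply j
    rwa [h2] at h1
  refine ⟨e.symm, fun j => ⟨hcl j, ?_⟩⟩
  have hc := hctrl _ (hEmem j)
  have hz : ‖(E j : Euc d) - E j‖ < C⁻¹ := by rw [sub_self, norm_zero]; exact inv_pos.mpr hC
  refine hc.crit _ _ hq (by rw [sub_self, norm_zero]; exact inv_pos.mpr hC) _ _ (hcl j) hz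
    (hc.inner_fderiv_eq_zero (hE'mem _) (hcl j)) (hc.inner_fderiv_eq_zero (hEmem j) hz)

/-- If the extended support keeps its cardinality near `y`, then the dual solution does not move when
`y` is displaced by a small combination of the vectors `φ(x)`, `x ∈ E_y`. With `q` the displacement
of the dual solution, `λ ‖q‖² ≤ ∑ (a_j + c_j) ⟨φ(x_j), q⟩`; the points of the extended support
moving by `O(‖q‖)`, each `η(x_j) ⟨φ(x_j), q⟩` is nonpositive and at least `-C² ‖q‖²`. -/
theorem eventually_dualSol_eq (hφ : ContinuousOn φ Ω)
    (hφ0 : Tendsto (fun x : Ω => φ x) (cocompact Ω) (𝓝 0)) (hlam : 0 < lam) {y : Euc n} {C : ℝ}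
    (hC : 0 < C) (hctrl : ∀ x ∈ extSupport Ω φ lam y, IsControlled Ω φ (dualSol Ω φ lam y) x C)
    {K : ℕ} {E : Fin K → Ω} (hEmem : ∀ j, (E j : Euc d) ∈ extSupport Ω φ lam y)
    (hEcov : ∀ x ∈ extSupport Ω φ lam y, ∃ j, (E j : Euc d) = x)
    (hK : ∀ᶠ y' in 𝓝 y, ∃ E' : Fin K → Ω, Function.Injective E' ∧
      ∀ j, (E' j : Euc d) ∈ extSupport Ω φ lam y')
    {a : Fin K → ℝ} (ha : y - lam • dualSol Ω φ lam y = ∑ j, a j • φ (E j))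
    (hsign : ∀ j, 0 ≤ a j * certificate Ω φ lam y (E j)) :
    ∀ᶠ c : Fin K → ℝ in 𝓝 0,
      dualSol Ω φ lam (y + ∑ j, c j • φ (E j)) = dualSol Ω φ lam y := by
  have htend : Tendsto (fun c : Fin K → ℝ => y + ∑ j, c j • φ (E j)) (𝓝 0) (𝓝 y) := by
    have h : Continuous fun c : Fin K → ℝ => y + ∑ j, c j • φ (E j) := by fun_prop
    have := h.tendsto 0
    simpa using this
  have hsmall : ∀ᶠ c : Fin K → ℝ in 𝓝 0, K * (‖c‖ * C ^ 2) < lam := by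
    have h : Continuous fun c : Fin K → ℝ => K * (‖c‖ * C ^ 2) := by fun_prop
    exact h.continuousAt.eventually_lt_const (by simpa using hlam)
  filter_upwards [htend.eventually hK, hsmall,
    htend.eventually (eventually_extSupport_near hφ hφ0 hlam y (inv_pos.mpr hC))] with c hc1 hc2 hc3
  obtain ⟨E', hE', hE'mem⟩ := hc1
  obtain ⟨hq, hnear⟩ := hc3
  set y' := y + ∑ j, c j • φ (E j) with hy'
  set p := dualSol Ω φ lam y with hp
  set p' := dualSol Ω φ lam y' with hp'
  obtain ⟨π, hπ⟩ := exists_matching hC hctrl hq hnear hEmem hEcov hE' hE'mem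
  set q := p' - p with hqdef
  let η : Fin K → ℝ := fun j => certificate Ω φ lam y (E j)
  have hηη : ∀ j, η j * η j = 1 := fun j => certificate_mul_self (hEmem j)
  have hηabs : ∀ j, |η j| = 1 := fun j => (hEmem j).2
  have hmul1 : ∀ j (t : ℝ), |t| ≤ 1 → η j * t ≤ 1 := fun j t ht => by
    refine (le_abs_self _).trans ?_
    rwa [abs_mul, hηabs, one_mul]
  have hs1 : ∀ j, η j * inner ℝ (φ (E j)) q ≤ 0 := fun j => by
    have h1 : inner ℝ (φ (E j)) q = PhiAdj φ p' (E j) - η j := inner_sub_right _ _ _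
    rw [h1, mul_sub, hηη]
    have := hmul1 j _ (dualSol_feasible Ω φ lam y' (E j) (E j).2)
    linarith
  have hs2 : ∀ j, -(C ^ 2 * ‖q‖ ^ 2) ≤ η j * inner ℝ (φ (E j)) q := fun j => by
    have hctl := hctrl _ (hEmem j)
    obtain ⟨hcl, hlip⟩ := hπ j
    set x' : Euc d := (E' (π j) : Euc d) with hx'
    have h1 : inner ℝ (φ (E j)) q = PhiAdj φ p' (E j) - η j := inner_sub_right _ _ _
    have hx'1 : |PhiAdj φ p' x'| = 1 := (hE'mem (π j)).2
    have hpos : 0 < η j * PhiAdj φ p' x' := hctl.sign p' hq x' hcl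
    have hone : η j * PhiAdj φ p' x' = 1 := by
      rw [← abs_of_pos hpos, abs_mul, hηabs, hx'1, one_mul]
    have h2 : η j * PhiAdj φ p x' ≤ 1 :=
      hmul1 j _ (dualSol_feasible Ω φ lam y x' (E' (π j)).2)
    have h3 : inner ℝ (φ x' - φ (E j)) q =
        (PhiAdj φ p' x' - PhiAdj φ p x') - (PhiAdj φ p' (E j) - η j) := by
      rw [inner_sub_left, h1, hqdef, inner_sub_right]; rfl
    have h4 : η j * inner ℝ (φ x' - φ (E j)) q ≤ C ^ 2 * ‖q‖ ^ 2 := by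
      refine (le_abs_self _).trans ?_
      rw [abs_mul, hηabs, one_mul]
      refine (abs_real_inner_le_norm _ _).trans ?_
      have hz : ‖(E j : Euc d) - E j‖ < C⁻¹ := by
        rw [sub_self, norm_zero]; exact inv_pos.mpr hC
      calc ‖φ x' - φ (E j)‖ * ‖q‖ ≤ C * (C * ‖q‖) * ‖q‖ := by
            gcongr
            exact (hctl.lip x' (E j) hcl hz).trans (by gcongr)
        _ = _ := by ring
    rw [h3, mul_sub, mul_sub, hone] at h4
    rw [h1]
    linarith
  have hqq : lam * ‖q‖ ^ 2 ≤ ∑ j, (a j + c j) * inner ℝ (φ (E j)) q := by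
    have h1 := dualSol_inner_le hlam y' (dualSol_feasible Ω φ lam y)
    have h2 : lam • q = ∑ j, (a j + c j) • φ (E j) - (y' - lam • p') := by
      simp only [add_smul, Finset.sum_add_distrib, ← ha]
      rw [hqdef, hy', smul_sub]
      abel
    have h3 : lam * ‖q‖ ^ 2 = inner ℝ (lam • q) q := by
      rw [real_inner_smul_left, real_inner_self_eq_norm_sq]
    have h4 : p - p' = -q := by rw [hqdef]; abel
    rw [← hp', ← hp, h4, inner_neg_right] at h1
    rw [h3, h2, inner_sub_left, sum_inner]
    simp only [real_inner_smul_left]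
    linarith
  have hterm : ∀ j, (a j + c j) * inner ℝ (φ (E j)) q ≤ ‖c‖ * (C ^ 2 * ‖q‖ ^ 2) := fun j => by
    have h1 : (a j + c j) * inner ℝ (φ (E j)) q =
        (a j * η j) * (η j * inner ℝ (φ (E j)) q) + (c j * η j) * (η j * inner ℝ (φ (E j)) q) := by
      linear_combination (-(a j + c j) * inner ℝ (φ (E j)) q) * hηη j
    have h2 : (a j * η j) * (η j * inner ℝ (φ (E j)) q) ≤ 0 :=
      mul_nonpos_of_nonneg_of_nonpos (hsign j) (hs1 j)
    have h3 : (c j * η j) * (η j * inner ℝ (φ (E j)) q) ≤ ‖c‖ * (C ^ 2 * ‖q‖ ^ 2) := by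
      refine (le_abs_self _).trans ?_
      rw [abs_mul, abs_mul, hηabs, mul_one]
      have h4 : |η j * inner ℝ (φ (E j)) q| ≤ C ^ 2 * ‖q‖ ^ 2 := by
        rw [abs_of_nonpos (hs1 j)]
        linarith [hs2 j]
      have h5 : |c j| ≤ ‖c‖ := norm_le_pi_norm c j
      gcongr
    rw [h1]
    linarith
  have hsum : ∑ j, (a j + c j) * inner ℝ (φ (E j)) q ≤ K * (‖c‖ * C ^ 2) * ‖q‖ ^ 2 := by
    refine (Finset.sum_le_sum fun j _ => hterm j).trans (le_of_eq ?_)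
    rw [Finset.sum_const, Finset.card_univ, Fintype.card_fin, nsmul_eq_mul]
    ring
  have hq0 : ‖q‖ ^ 2 = 0 := by
    by_contra hne
    have : 0 < ‖q‖ ^ 2 := lt_of_le_of_ne (sq_nonneg _) (Ne.symm hne)
    nlinarith
  exact sub_eq_zero.mp (norm_eq_zero.mp (pow_eq_zero_iff two_ne_zero |>.mp hq0))

/-! ### Consequences of avoiding the exceptional set -/

/-- Independent columns can be completed to a basis of the column space. -/
theorem exists_column_basis {K k : ℕ} (M : Matrix (Fin n) (Fin K) ℝ) {ι : Fin k → Fin K}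
    (hι : Function.Injective ι) (hM : Function.Injective (M.submatrix id ι).mulVec) :
    ∃ S : Finset (Fin K), (∀ i, ι i ∈ S) ∧
      Function.Injective (M.submatrix id (Subtype.val : S → Fin K)).mulVec ∧
      (∀ c, ∃ b, M *ᵥ c = M.submatrix id (Subtype.val : S → Fin K) *ᵥ b) ∧ M.rank = S.card := by
  classical
  have hli : LinearIndepOn ℝ M.col (range ι) := by
    rw [Matrix.mulVec_injective_iff] at hM
    exact (linearIndepOn_range_iff hι _).mpr hM
  obtain ⟨b, -, hb1, hb2, hb3⟩ := exists_linearIndepOn_extension hli (subset_univ _)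
  rw [image_univ] at hb2
  have hSb : ((b.toFinset : Finset (Fin K)) : Set (Fin K)) = b := by simp
  have hb3' : LinearIndependent ℝ (fun j : b.toFinset => M.col j) := by
    have := hb3
    rw [← hSb] at this
    exact this
  have hspan : Submodule.span ℝ (range M.col) =
      Submodule.span ℝ (range (fun j : b.toFinset => M.col j)) := by
    have h1 : range (fun j : b.toFinset => M.col j) = M.col '' b := by
      ext v; simp
    rw [h1]
    exact le_antisymm (Submodule.span_le.mpr hb2) (Submodule.span_mono (image_subset_range _ _))
  refine ⟨b.toFinset, fun i => by simpa using hb1 (mem_range_self i), ?_, ?_, ?_⟩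
  · rw [Matrix.mulVec_injective_iff]
    exact hb3'
  · intro c
    have h1 : M *ᵥ c ∈ Submodule.span ℝ (range M.col) := by
      rw [← Matrix.range_mulVecLin]
      exact ⟨c, rfl⟩
    have h2 : Submodule.span ℝ (range (fun j : b.toFinset => M.col j)) =
        (M.submatrix id (Subtype.val : b.toFinset → Fin K)).mulVecLin.range := by
      rw [Matrix.range_mulVecLin]; rfl
    rw [hspan, h2] at h1
    obtain ⟨e, he⟩ := h1
    exact ⟨e, he.symm⟩
  · rw [Matrix.rank_eq_finrank_span_cols, hspan, finrank_span_eq_card hb3']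
    simp

theorem PhiMat_transpose_mulVec {K : ℕ} (E : Fin K → Ω) (p : Euc n) :
    (PhiMat φ E)ᵀ *ᵥ (p : Fin n → ℝ) = fun j => PhiAdj φ p (E j) := by
  funext j
  simp [PhiMat, Matrix.mulVec, dotProduct, PhiAdj, PiLp.inner_apply, mul_comm]

/-- A signed combination of point masses on the extended support that represents `y - λ p_y` gives a
point of `Q` over `y`. -/
theorem mem_Q (hφ : ContinuousOn φ Ω) {y : Euc n} {K : ℕ}
    {E : Fin K → Ω} (hE : Function.Injective E)
    (hEmem : ∀ j, (E j : Euc d) ∈ extSupport Ω φ lam y) {a : Fin K → ℝ}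
    (ha : y - lam • dualSol Ω φ lam y = ∑ j, a j • φ (E j))
    (hsign : ∀ j, 0 ≤ a j * certificate Ω φ lam y (E j)) {S I : Finset (Fin K)} {σ : Fin K → ℝ}
    (hrank : (PhiMat φ E).rank = S.card)
    (hI : ∀ i : S, (i : Fin K) ∈ I → transferVec (PhiMat φ E) S lam σ y i = 0) :
    (y, a, E) ∈ Q Ω φ lam K S σ I := by
  have hle : ∀ x : Ω, |certificate Ω φ lam y x| ≤ 1 := fun x =>
    dualSol_feasible Ω φ lam y x x.2
  refine ⟨hE, hEmem, ⟨fun x => certificate Ω φ lam y x, ⟨?_, hle, ?_⟩, ?_⟩, hrank, hI⟩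
  · exact (continuousOn_iff_continuous_domRestrict.mp hφ).inner continuous_const
  · refine le_antisymm (integral_le_tvNorm _ hle) ?_
    rw [integral_discreteMeasure]
    refine (tvNorm_discreteMeasure_le a E).trans (Finset.sum_le_sum fun j _ => ?_)
    rw [smul_eq_mul, ← abs_of_nonneg (hsign j), abs_mul, (hEmem j).2, mul_one]
  · intro x
    have h1 : y - WithLp.toLp 2 (PhiMat φ E *ᵥ a) = lam • dualSol Ω φ lam y := by
      rw [toLp_PhiMat_mulVec, ← ha, sub_sub_cancel]
    change PhiAdj φ (y - WithLp.toLp 2 (PhiMat φ E *ᵥ a)) x = _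
    rw [h1, PhiAdj_smul]
    rfl

/-- Outside the exceptional set, membership in a projected set `Π_Y(Q)` is stable. -/
theorem eventually_mem_image_Q {y : Euc n} (hy : y ∉ exceptionalSet Ω φ lam) {K : ℕ} (hK : 1 ≤ K)
    {S I : Finset (Fin K)} {σ : Fin K → ℝ} (hσ : ∀ j, σ j = -1 ∨ σ j = 1) (hIS : I ⊆ S)
    (hmem : y ∈ Prod.fst '' Q Ω φ lam K S σ I) :
    ∀ᶠ y' in 𝓝 y, y' ∈ Prod.fst '' Q Ω φ lam K S σ I := by
  have h1 : y ∉ frontier (Prod.fst '' Q Ω φ lam K S σ I) := fun h =>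
    hy ⟨K, hK, σ, hσ, S, I, hIS, h⟩
  have h2 : y ∈ interior (Prod.fst '' Q Ω φ lam K S σ I) := by
    by_contra h
    exact h1 ⟨subset_closure hmem, h⟩
  exact mem_interior_iff_mem_nhds.mp h2

/-- Outside the exceptional set, the values of `φ` at the support points of an injective solution
span those at the extended support, and for nearby `y'` the extended support keeps its cardinality
while the rank of `φ` on it stays the same. -/
theorem eventually_extSupport_card (hφ : ContinuousOn φ Ω)
    (hφ0 : Tendsto (fun x : Ω => φ x) (cocompact Ω) (𝓝 0)) (hlam : 0 < lam) {y : Euc n}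
    (hy : y ∉ exceptionalSet Ω φ lam) {C : ℝ} (hC : 0 < C)
    (hctrl : ∀ x ∈ extSupport Ω φ lam y, IsControlled Ω φ (dualSol Ω φ lam y) x C)
    {K : ℕ} {E : Fin K → Ω} (hE : Function.Injective E)
    (hEmem : ∀ j, (E j : Euc d) ∈ extSupport Ω φ lam y)
    (hEcov : ∀ x ∈ extSupport Ω φ lam y, ∃ j, (E j : Euc d) = x)
    {k : ℕ} {ι : Fin k → Fin K} (hι : Function.Injective ι)
    (hinj : Function.Injective (PhiMat φ (E ∘ ι)).mulVec) {β : Fin k → ℝ}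
    (hres : y - lam • dualSol Ω φ lam y = ∑ i, β i • φ (E (ι i)))
    (hsign : ∀ i, 0 < β i * certificate Ω φ lam y (E (ι i))) :
    ∀ᶠ y' in 𝓝 y, ∃ E' : Fin K → Ω, Function.Injective E' ∧
      (∀ j, (E' j : Euc d) ∈ extSupport Ω φ lam y') ∧ (PhiMat φ E').rank = k := by
  rcases Nat.eq_zero_or_pos K with rfl | hKpos
  · have hk : k = 0 := by
      by_contra hk
      exact (ι ⟨0, Nat.pos_of_ne_zero hk⟩).elim0
    subst hk
    exact Eventually.of_forall fun y' => ⟨(Fin.elim0 ·), fun i => i.elim0, fun i => i.elim0,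
      Nat.le_zero.mp ((Matrix.rank_le_width _))⟩
  set M := PhiMat φ E with hM
  have hMι : PhiMat φ (E ∘ ι) = M.submatrix id ι := rfl
  obtain ⟨S, hιS, hSinj, hSrange, hrank⟩ := exists_column_basis M hι (hMι ▸ hinj)
  set a : Fin K → ℝ := Function.extend ι β 0 with hadef
  have haι : ∀ i, a (ι i) = β i := fun i => hι.extend_apply _ _ i
  have ha0 : ∀ j, j ∉ range ι → a j = 0 := fun j hj =>
    Function.extend_apply' _ _ _ hj
  have hares : y - lam • dualSol Ω φ lam y = ∑ j, a j • φ (E j) := by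
    rw [hres]
    refine Fintype.sum_of_injective ι hι _ _ (fun j hj => ?_) fun i => ?_
    · rw [ha0 j hj, zero_smul]
    · rw [haι]
  have hasign : ∀ j, 0 ≤ a j * certificate Ω φ lam y (E j) := fun j => by
    by_cases hj : j ∈ range ι
    · obtain ⟨i, rfl⟩ := hj
      rw [haι]
      exact (hsign i).le
    · rw [ha0 j hj, zero_mul]
  set σ : Fin K → ℝ := fun j => certificate Ω φ lam y (E j) with hσdef
  have hσ : ∀ j, σ j = -1 ∨ σ j = 1 := fun j =>
    ((abs_eq one_pos.le).mp (hEmem j).2).symm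
  have htransfer : ∀ i : S, transferVec M S lam σ y i = a i := fun i => by
    refine transferVec_apply_eq M S lam σ a y (dualSol Ω φ lam y) hSinj hSrange
      (PhiMat_transpose_mulVec E _) ?_ (fun j hj => ha0 j fun ⟨l, hl⟩ => hj (hl ▸ hιS l)) i
    have h := hares
    rw [← toLp_PhiMat_mulVec] at h
    exact congrArg WithLp.ofLp h
  have hmem : ∀ I : Finset (Fin K), (∀ i ∈ I, i ∉ range ι) →
      y ∈ Prod.fst '' Q Ω φ lam K S σ I := fun I hI =>
    ⟨(y, a, E), mem_Q hφ hE hEmem hares hasign hrank fun i hi => by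
      rw [htransfer i, ha0 _ (hI _ hi)], rfl⟩
  have hcard : ∀ᶠ y' in 𝓝 y, ∃ E' : Fin K → Ω, Function.Injective E' ∧
      (∀ j, (E' j : Euc d) ∈ extSupport Ω φ lam y') ∧ (PhiMat φ E').rank = S.card := by
    filter_upwards [eventually_mem_image_Q hy hKpos hσ (Finset.empty_subset S)
      (hmem ∅ (by simp))] with y' hy'
    obtain ⟨⟨z, a', E'⟩, ⟨h1, h2, -, h4, -⟩, rfl⟩ := hy'
    exact ⟨E', h1, h2, h4⟩
  -- an index `i` of the basis outside the support would make an entry of the transfer vector vanish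
  -- for all `y'` near `y`, but the displacements along the range of `M` forbid this
  have hSι : ∀ i ∈ S, i ∈ range ι := by
    intro i hiS
    by_contra hi
    have hmemi := eventually_mem_image_Q hy hKpos hσ (Finset.singleton_subset_iff.mpr hiS)
      (hmem {i} (by simpa using hi))
    have hdual := eventually_dualSol_eq hφ hφ0 hlam hC hctrl hEmem hEcov
      (hcard.mono fun y' ⟨E', h1, h2, _⟩ => ⟨E', h1, h2⟩) hares hasign
    have htend : Tendsto (fun c : Fin K → ℝ => y + ∑ j, c j • φ (E j)) (𝓝 0) (𝓝 y) := by
      have h : Continuous fun c : Fin K → ℝ => y + ∑ j, c j • φ (E j) := by fun_prop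
      have := h.tendsto 0
      simpa using this
    obtain ⟨ε, hε, hball⟩ := Metric.eventually_nhds_iff.mp
      ((htend.eventually hmemi).and hdual)
    have hcol : ∀ j, ∃ r, M r j ≠ 0 := by
      intro j
      by_contra hzero
      push Not at hzero
      have h0 : φ (E j) = 0 := by ext r; exact hzero r
      have h1 : |PhiAdj φ (dualSol Ω φ lam y) (E j)| = 1 := (hEmem j).2
      rw [PhiAdj, h0, inner_zero_left, abs_zero] at h1
      exact zero_ne_one h1
    obtain ⟨c, hc, hne⟩ := exists_small_transferVec_ne_zero M hcol S ⟨i, hiS⟩ lam σ y hε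
    obtain ⟨⟨⟨z, a', E'⟩, ⟨h1, h2, -, -, h5⟩, hz⟩, hp⟩ := hball (y := c) (by simpa using hc)
    simp only at hz h1 h2 h5
    have hEE : ∀ j, ∃ l, E l = E' j := fun j => by
      have h6 := h2 j
      rw [hz, extSupport, certificate, hp] at h6
      obtain ⟨l, hl⟩ := hEcov _ h6
      exact ⟨l, Subtype.ext hl⟩
    choose f hf using hEE
    have hfinj : Function.Injective f := fun i j hij => h1 (by rw [← hf, ← hf, hij])
    have hπ : PhiMat φ E' =
        M.submatrix id (Equiv.ofBijective f (Finite.injective_iff_bijective.mp hfinj)) := by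
      ext r j
      simp [M, PhiMat, hf]
    have h7 := h5 ⟨i, hiS⟩ (Finset.mem_singleton_self i)
    rw [hπ, hz, ← toLp_PhiMat_mulVec] at h7
    exact hne _ h7
  have hSk : S.card = k := by
    have : S = Finset.univ.map ⟨ι, hι⟩ := by
      ext j
      simp only [Finset.mem_map, Finset.mem_univ, true_and, Function.Embedding.coeFn_mk]
      exact ⟨fun h => hSι j h, fun ⟨l, hl⟩ => hl ▸ hιS l⟩
    rw [this, Finset.card_map, Finset.card_univ, Fintype.card_fin]
  rwa [hSk] at hcard

/-! ### The stationarity equations and their implicit solution -/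

/-- The value `Φ m_{β,X} = ∑ j, β_j φ(x_j)` as a function of amplitudes and positions. -/
def synthesis (φ : Euc d → Euc n) {k : ℕ} (z : (Fin k → ℝ) × (Fin k → Euc d)) : Euc n :=
  ∑ j, z.1 j • φ (z.2 j)

/-- The left-hand sides of the stationarity equations: with `r = y - ∑ j, β_j φ(x_j)`, the values
`⟨φ(x_j), r⟩` and the linear forms `v ↦ ⟨Dφ(x_j) v, r⟩`. -/
def stationarity (φ : Euc d → Euc n) {k : ℕ} (u : Euc n × (Fin k → ℝ) × (Fin k → Euc d)) :
    (Fin k → ℝ) × (Fin k → Euc d →L[ℝ] ℝ) :=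
  (fun j => inner ℝ (φ (u.2.2 j)) (u.1 - synthesis φ u.2),
    fun j => (innerSL ℝ (u.1 - synthesis φ u.2)).comp (fderiv ℝ φ (u.2.2 j)))

/-- The directional derivative of `synthesis`. -/
def synthesisDeriv (φ : Euc d → Euc n) {k : ℕ} (z w : (Fin k → ℝ) × (Fin k → Euc d)) : Euc n :=
  ∑ j, (w.1 j • φ (z.2 j) + z.1 j • fderiv ℝ φ (z.2 j) (w.2 j))

theorem contDiffAt_synthesis {k : ℕ} {z : (Fin k → ℝ) × (Fin k → Euc d)}
    (hz : ∀ j, ContDiffAt ℝ 2 φ (z.2 j)) : ContDiffAt ℝ 1 (synthesis (k := k) φ) z := by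
  unfold synthesis
  refine ContDiffAt.sum fun j _ => ?_
  have h1 : ContDiffAt ℝ 1 (fun z : (Fin k → ℝ) × (Fin k → Euc d) => z.1 j) z := by fun_prop
  refine h1.smul ?_
  exact ((hz j).of_le (by norm_num)).comp z (f := fun z : (Fin k → ℝ) × (Fin k → Euc d) => z.2 j)
    (by fun_prop)

theorem contDiffAt_stationarity {k : ℕ} {u : Euc n × (Fin k → ℝ) × (Fin k → Euc d)}
    (hu : ∀ j, ContDiffAt ℝ 2 φ (u.2.2 j)) :
    ContDiffAt ℝ 1 (stationarity (k := k) φ) u := by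
  have hr : ContDiffAt ℝ 1
      (fun u : Euc n × (Fin k → ℝ) × (Fin k → Euc d) => u.1 - synthesis φ u.2) u :=
    contDiffAt_fst.sub ((contDiffAt_synthesis hu).comp u contDiffAt_snd)
  refine ContDiffAt.prodMk (contDiffAt_pi.mpr fun j => ?_) (contDiffAt_pi.mpr fun j => ?_)
  · refine ContDiffAt.inner ℝ ?_ hr
    exact ((hu j).of_le (by norm_num)).comp u
      (f := fun u : Euc n × (Fin k → ℝ) × (Fin k → Euc d) => u.2.2 j) (by fun_prop)
  · refine ContDiffAt.clm_comp ((innerSL ℝ).contDiff.contDiffAt.comp u hr) ?_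
    exact ((hu j).fderiv_right (m := 1) (by norm_num)).comp u
      (f := fun u : Euc n × (Fin k → ℝ) × (Fin k → Euc d) => u.2.2 j) (by fun_prop)

theorem fderiv_synthesis_apply {k : ℕ} {z : (Fin k → ℝ) × (Fin k → Euc d)}
    (hz : ∀ j, ContDiffAt ℝ 2 φ (z.2 j)) (w : (Fin k → ℝ) × (Fin k → Euc d)) :
    fderiv ℝ (synthesis (k := k) φ) z w = synthesisDeriv φ z w := by
  have h : HasFDerivAt (synthesis (k := k) φ) (∑ j : Fin k,
      (z.1 j • ((fderiv ℝ φ (z.2 j)).comp ((ContinuousLinearMap.proj j).comp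
        (ContinuousLinearMap.snd ℝ (Fin k → ℝ) (Fin k → Euc d)))) +
      ((ContinuousLinearMap.proj j).comp
        (ContinuousLinearMap.fst ℝ (Fin k → ℝ) (Fin k → Euc d))).smulRight (φ (z.2 j)))) z := by
    unfold synthesis
    refine HasFDerivAt.fun_sum fun j _ => ?_
    refine HasFDerivAt.smul (c := fun z : (Fin k → ℝ) × (Fin k → Euc d) => z.1 j)
      (f := fun z : (Fin k → ℝ) × (Fin k → Euc d) => φ (z.2 j)) ?_ ?_
    · exact ((ContinuousLinearMap.proj j).comp
        (ContinuousLinearMap.fst ℝ (Fin k → ℝ) (Fin k → Euc d))).hasFDerivAt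
    · exact ((hz j).differentiableAt (by simp)).hasFDerivAt.comp z ((ContinuousLinearMap.proj j).comp
        (ContinuousLinearMap.snd ℝ (Fin k → ℝ) (Fin k → Euc d))).hasFDerivAt
  rw [h.fderiv]
  simp [synthesisDeriv, sum_apply, add_comm]

theorem fderiv_stationarity_apply {k : ℕ} {u : Euc n × (Fin k → ℝ) × (Fin k → Euc d)}
    (hu : ∀ j, ContDiffAt ℝ 2 φ (u.2.2 j)) (h : Euc n) (w : (Fin k → ℝ) × (Fin k → Euc d)) :
    fderiv ℝ (stationarity (k := k) φ) u (h, w) =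
      (fun j => inner ℝ (φ (u.2.2 j)) (h - synthesisDeriv φ u.2 w) +
          inner ℝ (fderiv ℝ φ (u.2.2 j) (w.2 j)) (u.1 - synthesis φ u.2),
        fun j => (innerSL ℝ (u.1 - synthesis φ u.2)).comp
            (fderiv ℝ (fderiv ℝ φ) (u.2.2 j) (w.2 j)) +
          (innerSL ℝ (h - synthesisDeriv φ u.2 w)).comp (fderiv ℝ φ (u.2.2 j))) := by
  have hline : HasDerivAt (fun t : ℝ => stationarity φ (u + t • (h, w)))
      (fderiv ℝ (stationarity φ) u (h, w)) 0 :=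
    ((contDiffAt_stationarity hu).differentiableAt (by simp)).hasFDerivAt.hasLineDerivAt (h, w)
  have hu0 : u + (0 : ℝ) • (h, w) = u := by simp
  have hr : HasDerivAt (fun t : ℝ => (u + t • (h, w)).1 - synthesis φ (u + t • (h, w)).2)
      (h - synthesisDeriv φ u.2 w) 0 := by
    have h1 : HasDerivAt (fun t : ℝ => (u + t • (h, w)).1) h 0 := by
      have := ((hasDerivAt_id (0 : ℝ)).smul_const h).const_add u.1
      simpa using this
    have h2 : HasDerivAt (fun t : ℝ => synthesis φ (u + t • (h, w)).2)
        (synthesisDeriv φ u.2 w) 0 := by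
      have := ((contDiffAt_synthesis hu).differentiableAt (by simp)).hasFDerivAt.hasLineDerivAt w
      rw [fderiv_synthesis_apply hu] at this
      exact this
    exact h1.sub h2
  have hx : ∀ j, HasDerivAt (fun t : ℝ => (u + t • (h, w)).2.2 j) (w.2 j) 0 := fun j => by
    have := ((hasDerivAt_id (0 : ℝ)).smul_const (w.2 j)).const_add (u.2.2 j)
    simpa using this
  have hφx : ∀ j, HasDerivAt (fun t : ℝ => φ ((u + t • (h, w)).2.2 j))
      (fderiv ℝ φ (u.2.2 j) (w.2 j)) 0 := fun j => by
    refine HasFDerivAt.comp_hasDerivAt (x := (0 : ℝ)) (l := φ) ?_ (hx j)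
    rw [hu0]
    exact ((hu j).differentiableAt (by simp)).hasFDerivAt
  have hDφx : ∀ j, HasDerivAt (fun t : ℝ => fderiv ℝ φ ((u + t • (h, w)).2.2 j))
      (fderiv ℝ (fderiv ℝ φ) (u.2.2 j) (w.2 j)) 0 := fun j => by
    refine HasFDerivAt.comp_hasDerivAt (x := (0 : ℝ)) (l := fderiv ℝ φ) ?_ (hx j)
    rw [hu0]
    exact (((hu j).fderiv_right (m := 1) (by norm_num)).differentiableAt (by simp)).hasFDerivAt
  refine hline.unique (HasDerivAt.prodMk (hasDerivAt_pi.mpr fun j => ?_)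
    (hasDerivAt_pi.mpr fun j => ?_))
  · have := (hφx j).inner ℝ hr
    rw [hu0] at this
    exact this
  · have h1 : HasDerivAt (fun t : ℝ =>
        innerSL ℝ ((u + t • (h, w)).1 - synthesis φ (u + t • (h, w)).2))
        (innerSL ℝ (h - synthesisDeriv φ u.2 w)) 0 :=
      (innerSL ℝ).hasFDerivAt.comp_hasDerivAt (0 : ℝ) hr
    have := h1.clm_comp (hDφx j)
    rw [hu0, add_comm] at this
    exact this

/-- The data of a nondegenerate stationary point: `p` is the dual vector, `β` and `X` the amplitudes
and positions. -/
structure IsNondegenerate (φ : Euc d → Euc n) (lam : ℝ) (y p : Euc n) {k : ℕ}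
    (z : (Fin k → ℝ) × (Fin k → Euc d)) : Prop where
  smooth : ∀ j, ContDiffAt ℝ 2 φ (z.2 j)
  residual : y - synthesis φ z = lam • p
  crit : ∀ j v, inner ℝ (fderiv ℝ φ (z.2 j) v) p = 0
  neg : ∀ j v, v ≠ 0 → z.1 j * inner ℝ (fderiv ℝ (fderiv ℝ φ) (z.2 j) v v) p < 0
  indep : ∀ b : Fin k → ℝ, ∑ j, b j • φ (z.2 j) = 0 → b = 0

/-- The linearized stationarity equations in the direction `(h, w)`, at a nondegenerate point. -/
theorem IsNondegenerate.fderiv_eq_zero_iff {y p : Euc n} {k : ℕ}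
    {z : (Fin k → ℝ) × (Fin k → Euc d)} (hz : IsNondegenerate φ lam y p z) (h : Euc n)
    (w : (Fin k → ℝ) × (Fin k → Euc d)) :
    fderiv ℝ (stationarity φ) (y, z) (h, w) = 0 ↔
      (∀ j, inner ℝ (φ (z.2 j)) (h - synthesisDeriv φ z w) = 0) ∧
      ∀ j v, inner ℝ (fderiv ℝ φ (z.2 j) v) (h - synthesisDeriv φ z w) +
        lam * inner ℝ (fderiv ℝ (fderiv ℝ φ) (z.2 j) (w.2 j) v) p = 0 := by
  rw [fderiv_stationarity_apply (u := (y, z)) hz.smooth, Prod.mk_eq_zero, funext_iff, funext_iff]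
  refine and_congr (forall_congr' fun j => ?_) (forall_congr' fun j => ?_)
  · simp only [hz.residual, real_inner_smul_right, hz.crit, mul_zero, add_zero, Pi.zero_apply]
  · rw [ContinuousLinearMap.ext_iff]
    refine forall_congr' fun v => ?_
    simp only [hz.residual, Pi.zero_apply, add_apply, ContinuousLinearMap.comp_apply,
      innerSL_apply_apply, zero_apply, real_inner_smul_left]
    rw [add_comm, real_inner_comm, real_inner_comm p]

/-- At a nondegenerate point, the linearized stationarity equations determine the variation of
amplitudes and positions: testing them against this variation gives
`‖μ‖² = λ ∑ β_j ⟨D²φ(x_j) v_j v_j, p⟩ ≤ 0`, with `μ` the variation of `Φ m`. -/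
theorem IsNondegenerate.injective (hlam : 0 < lam) {y p : Euc n} {k : ℕ}
    {z : (Fin k → ℝ) × (Fin k → Euc d)} (hz : IsNondegenerate φ lam y p z)
    {w : (Fin k → ℝ) × (Fin k → Euc d)}
    (hw : fderiv ℝ (stationarity φ) (y, z) (0, w) = 0) : w = 0 := by
  obtain ⟨h1, h2⟩ := (hz.fderiv_eq_zero_iff 0 w).mp hw
  set μ := synthesisDeriv φ z w with hμ
  simp only [zero_sub, inner_neg_right, neg_eq_zero] at h1 h2
  have h3 : ∀ j v, inner ℝ (fderiv ℝ φ (z.2 j) v) μ =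
      lam * inner ℝ (fderiv ℝ (fderiv ℝ φ) (z.2 j) (w.2 j) v) p := fun j v => by
    linarith [h2 j v]
  have hsq : ‖μ‖ ^ 2 =
      ∑ j, lam * (z.1 j * inner ℝ (fderiv ℝ (fderiv ℝ φ) (z.2 j) (w.2 j) (w.2 j)) p) := by
    have h4 : inner ℝ (synthesisDeriv φ z w) μ = ∑ j, inner ℝ
        (w.1 j • φ (z.2 j) + z.1 j • fderiv ℝ φ (z.2 j) (w.2 j)) μ := sum_inner _ _ _
    rw [← real_inner_self_eq_norm_sq, h4]
    refine Finset.sum_congr rfl fun j _ => ?_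
    rw [inner_add_left, real_inner_smul_left, real_inner_smul_left, h1, h3]
    ring
  have hle : ∀ j ∈ Finset.univ,
      lam * (z.1 j * inner ℝ (fderiv ℝ (fderiv ℝ φ) (z.2 j) (w.2 j) (w.2 j)) p) ≤ 0 := by
    intro j _
    by_cases hv : w.2 j = 0
    · simp [hv]
    · exact (mul_neg_of_pos_of_neg hlam (hz.neg j _ hv)).le
  have hsum0 : ∑ j, lam * (z.1 j * inner ℝ (fderiv ℝ (fderiv ℝ φ) (z.2 j) (w.2 j) (w.2 j)) p) = 0 :=
    le_antisymm (Finset.sum_nonpos hle) (hsq ▸ sq_nonneg _)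
  have hV : w.2 = 0 := by
    funext j
    by_contra hv
    have := (Finset.sum_eq_zero_iff_of_nonpos hle).mp hsum0 j (Finset.mem_univ j)
    exact (mul_neg_of_pos_of_neg hlam (hz.neg j _ hv)).ne this
  have hμ0 : μ = 0 := by
    rw [hsum0] at hsq
    exact norm_eq_zero.mp (pow_eq_zero_iff two_ne_zero |>.mp hsq)
  have hb : w.1 = 0 := by
    refine hz.indep _ ?_
    rw [hμ, synthesisDeriv] at hμ0
    simpa [hV] using hμ0
  exact Prod.ext hb hV

/-- Near a nondegenerate point the stationarity equations define amplitudes and positions as `C¹`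
functions of the observation, with the derivative given by the linearized equations. -/
theorem IsNondegenerate.exists_implicit (hlam : 0 < lam) {y p : Euc n} {k : ℕ}
    {z : (Fin k → ℝ) × (Fin k → Euc d)} (hz : IsNondegenerate φ lam y p z) :
    ∃ ψ : Euc n → (Fin k → ℝ) × (Fin k → Euc d), ψ y = z ∧ ContDiffAt ℝ 1 ψ y ∧
      (∀ h, fderiv ℝ (stationarity φ) (y, z) (h, fderiv ℝ ψ y h) = 0) ∧
      ∀ᶠ u in 𝓝 (y, z), stationarity φ u = stationarity φ (y, z) → ψ u.1 = u.2 := by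
  have hc : ContDiffAt ℝ 1 (stationarity (k := k) φ) (y, z) := contDiffAt_stationarity hz.smooth
  have hinv : (fderiv ℝ (stationarity (k := k) φ) (y, z) ∘L .inr ℝ (Euc n) _).IsInvertible := by
    set T := fderiv ℝ (stationarity (k := k) φ) (y, z) ∘L .inr ℝ (Euc n) _ with hT
    have hinj : Function.Injective T.toLinearMap := by
      refine (injective_iff_map_eq_zero _).mpr fun w hw => hz.injective hlam ?_
      exact hw
    have hdual : Module.finrank ℝ (Euc d →L[ℝ] ℝ) = d := by
      rw [← (LinearMap.toContinuousLinearMap (𝕜 := ℝ) (E := Euc d) (F' := ℝ)).finrank_eq]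
      rw [Module.finrank_linearMap]
      simp
    have hfd : FiniteDimensional ℝ (Euc d →L[ℝ] ℝ) :=
      (LinearMap.toContinuousLinearMap (𝕜 := ℝ) (E := Euc d) (F' := ℝ)).finiteDimensional
    have hrank : Module.finrank ℝ ((Fin k → ℝ) × (Fin k → Euc d)) =
        Module.finrank ℝ ((Fin k → ℝ) × (Fin k → Euc d →L[ℝ] ℝ)) := by
      rw [Module.finrank_prod, Module.finrank_prod, Module.finrank_pi_fintype,
        Module.finrank_pi_fintype, Module.finrank_pi_fintype, hdual]
      simp
    refine ⟨(LinearMap.linearEquivOfInjective T.toLinearMap hinj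
      hrank).toContinuousLinearEquiv, ?_⟩
    ext w <;> rfl
  refine ⟨hc.implicitFunction (by simp) hinv, hc.implicitFunction_apply_self (by simp) hinv,
    hc.contDiffAt_implicitFunction (by simp) hinv, fun h => ?_, ?_⟩
  · set ψ := hc.implicitFunction (by simp) hinv with hψ
    have hψy : ψ y = z := hc.implicitFunction_apply_self (by simp) hinv
    have hψd : DifferentiableAt ℝ ψ y :=
      (hc.contDiffAt_implicitFunction (by simp) hinv).differentiableAt (by simp)
    have h1 : HasFDerivAt (fun y' => (y', ψ y')) ((ContinuousLinearMap.id ℝ (Euc n)).prod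
        (fderiv ℝ ψ y)) y := (hasFDerivAt_id y).prodMk hψd.hasFDerivAt
    have h2 : HasFDerivAt (stationarity (k := k) φ) (fderiv ℝ (stationarity φ) (y, z)) (y, ψ y) := by
      rw [hψy]
      exact (hc.differentiableAt (by simp)).hasFDerivAt
    have h3 := h2.comp y h1
    have h4 : HasFDerivAt (stationarity φ ∘ fun y' => (y', ψ y'))
        (0 : Euc n →L[ℝ] (Fin k → ℝ) × (Fin k → Euc d →L[ℝ] ℝ)) y := by
      refine (hasFDerivAt_const (stationarity φ (y, z)) y).congr_of_eventuallyEq ?_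
      exact hc.eventually_apply_implicitFunction (by simp) hinv
    exact DFunLike.congr_fun (h3.unique h4) h
  · exact (hc.eventually_apply_eq_iff_implicitFunction (by simp) hinv).mono fun u hu => hu.mp

/-! ### The curvature matrix -/

theorem euc_eq_sum_single (v : Euc d) : v = ∑ l, v l • EuclideanSpace.single l (1 : ℝ) := by
  ext i
  simp [Pi.single_apply]

/-- The vector `(b, β_j v_j)`: the block index runs over amplitudes and partial derivatives, and
scaling the displacements `v_j` by `β_j` makes the linearized equations symmetric. -/
def scaledVec {k : ℕ} (β : Fin k → ℝ) (w : (Fin k → ℝ) × (Fin k → Euc d)) :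
    Fin k ⊕ Fin d × Fin k → ℝ :=
  Sum.elim w.1 fun lj => β lj.2 * w.2 lj.2 lj.1

theorem Gam_mulVec_scaledVec {k : ℕ} (β : Fin k → ℝ) (A : Fin k → Ω)
    (w : (Fin k → ℝ) × (Fin k → Euc d)) :
    WithLp.toLp 2 (Gam φ A *ᵥ scaledVec β w) =
      synthesisDeriv φ (β, fun j => (A j : Euc d)) w := by
  rw [Gam, scaledVec, Matrix.fromCols_mulVec_sumElim, WithLp.toLp_add, toLp_PhiMat_mulVec,
    synthesisDeriv, Finset.sum_add_distrib]
  congr 1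
  have h : ∀ j, fderiv ℝ φ (A j) (w.2 j) =
      ∑ l, w.2 j l • fderiv ℝ φ (A j) (EuclideanSpace.single l 1) := fun j => by
    conv_lhs => rw [euc_eq_sum_single (w.2 j)]
    simp only [map_sum, map_smul]
  ext i
  simp only [h, Matrix.mulVec, dotProduct, Matrix.of_apply, WithLp.ofLp_sum, WithLp.ofLp_smul,
    Finset.sum_apply, Pi.smul_apply, smul_eq_mul, Finset.mul_sum]
  rw [Fintype.sum_prod_type, Finset.sum_comm]
  exact Finset.sum_congr rfl fun j _ => Finset.sum_congr rfl fun l _ => by ring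

theorem Gam_transpose_mulVec {k : ℕ} (A : Fin k → Ω) (h : Euc n) :
    (Gam φ A)ᵀ *ᵥ (h : Fin n → ℝ) = Sum.elim (fun j => inner ℝ (φ (A j)) h)
      fun lj => inner ℝ (fderiv ℝ φ (A lj.2) (EuclideanSpace.single lj.1 1)) h := by
  funext s
  rcases s with j | lj <;>
    simp [Gam, PhiMat, Matrix.mulVec, dotProduct, PiLp.inner_apply, mul_comm]

theorem hessian_mulVec_scaledVec {y : Euc n} {k : ℕ} {β : Fin k → ℝ} (hβ : ∀ j, β j ≠ 0)
    {A : Fin k → Ω} (hA : ∀ j, ContDiffAt ℝ 2 φ (A j)) (w : (Fin k → ℝ) × (Fin k → Euc d)) :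
    Matrix.fromBlocks 0 0 0 (Matrix.blockDiagonal fun j =>
        (-(lam / β j)) • hessian (certificate Ω φ lam y) (A j)) *ᵥ scaledVec β w =
      Sum.elim (0 : Fin k → ℝ) fun lj => -(lam * inner ℝ (fderiv ℝ (fderiv ℝ φ) (A lj.2) (w.2 lj.2)
        (EuclideanSpace.single lj.1 1)) (dualSol Ω φ lam y)) := by
  rw [scaledVec, Matrix.fromBlocks_mulVec]
  simp only [Sum.elim_comp_inl, Sum.elim_comp_inr, Matrix.zero_mulVec, add_zero, zero_add]
  congr 1
  funext ⟨l, j⟩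
  have hsymm : IsSymmSndFDerivAt ℝ φ (A j : Euc d) := (hA j).isSymmSndFDerivAt (by simp)
  rw [hsymm.eq (w.2 j) (EuclideanSpace.single l 1)]
  conv_rhs => rw [euc_eq_sum_single (w.2 j)]
  simp only [map_sum, map_smul, sum_inner, real_inner_smul_left,
    ← hessian_PhiAdj (hA j)]
  simp only [Matrix.mulVec, dotProduct, Matrix.blockDiagonal_apply, Matrix.smul_apply, ite_mul,
    zero_mul, smul_eq_mul]
  rw [Fintype.sum_prod_type]
  simp only [Finset.sum_ite_eq, Finset.mem_univ, if_true]
  rw [Finset.mul_sum, ← Finset.sum_neg_distrib]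
  refine Finset.sum_congr rfl fun l' _ => ?_
  have := hβ j
  rw [certificate]
  field_simp

/-- In the scaled variables the linearized stationarity equations read `M w = Γᵀ h`, with `M` the
curvature matrix. -/
theorem curvatureMat_mulVec_eq_iff {y : Euc n} {k : ℕ} {β : Fin k → ℝ} (hβ : ∀ j, β j ≠ 0)
    {A : Fin k → Ω}
    (hz : IsNondegenerate φ lam y (dualSol Ω φ lam y) (β, fun j => (A j : Euc d)))
    (w : (Fin k → ℝ) × (Fin k → Euc d)) (h : Euc n) :
    curvatureMat Ω φ lam y β A *ᵥ scaledVec β w = (Gam φ A)ᵀ *ᵥ (h : Fin n → ℝ) ↔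
      fderiv ℝ (stationarity φ) (y, (β, fun j => (A j : Euc d))) (h, w) = 0 := by
  rw [hz.fderiv_eq_zero_iff, curvatureMat, Matrix.add_mulVec, hessian_mulVec_scaledVec hβ hz.smooth,
    ← Matrix.mulVec_mulVec]
  have hΓ : Gam φ A *ᵥ scaledVec β w =
      (synthesisDeriv φ (β, fun j => (A j : Euc d)) w : Fin n → ℝ) := by
    rw [← Gam_mulVec_scaledVec]
  rw [hΓ, Gam_transpose_mulVec, Gam_transpose_mulVec, funext_iff, Sum.forall]
  refine and_congr (forall_congr' fun j => ?_) ⟨fun H j v => ?_, fun H lj => ?_⟩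
  · simp only [Pi.add_apply, Sum.elim_inl, Pi.zero_apply, add_zero, inner_sub_right]
    rw [sub_eq_zero, eq_comm]
  · have H' : ∀ l, inner ℝ (fderiv ℝ φ (A j) (EuclideanSpace.single l 1))
        (h - synthesisDeriv φ (β, fun j => (A j : Euc d)) w) +
        lam * inner ℝ (fderiv ℝ (fderiv ℝ φ) (A j) (w.2 j) (EuclideanSpace.single l 1))
          (dualSol Ω φ lam y) = 0 := fun l => by
      have := H (l, j)
      simp only [Pi.add_apply, Sum.elim_inr] at this
      rw [inner_sub_right]
      linarith
    rw [euc_eq_sum_single v]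
    simp only [map_sum, map_smul, sum_inner, real_inner_smul_left, Finset.mul_sum]
    rw [← Finset.sum_add_distrib]
    refine Finset.sum_eq_zero fun l _ => ?_
    linear_combination v l * H' l
  · have := H lj.2 (EuclideanSpace.single lj.1 1)
    rw [inner_sub_right] at this
    simp only [Pi.add_apply, Sum.elim_inr]
    linarith

theorem isUnit_det_curvatureMat (hlam : 0 < lam) {y : Euc n} {k : ℕ} {β : Fin k → ℝ}
    (hβ : ∀ j, β j ≠ 0) {A : Fin k → Ω}
    (hz : IsNondegenerate φ lam y (dualSol Ω φ lam y) (β, fun j => (A j : Euc d))) :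
    IsUnit (curvatureMat Ω φ lam y β A).det := by
  rw [← Matrix.isUnit_iff_isUnit_det, ← Matrix.mulVec_injective_iff_isUnit]
  refine (injective_iff_map_eq_zero (curvatureMat Ω φ lam y β A).mulVecLin).mpr fun s hs => ?_
  set w : (Fin k → ℝ) × (Fin k → Euc d) :=
    (fun j => s (Sum.inl j), fun j => WithLp.toLp 2 fun l => (β j)⁻¹ * s (Sum.inr (l, j))) with hw
  have hsw : s = scaledVec β w := by
    funext i
    rcases i with j | ⟨l, j⟩
    · rfl
    · simp [scaledVec, hw, mul_inv_cancel_left₀ (hβ j)]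
  have h0 : w = 0 := by
    refine hz.injective hlam ((curvatureMat_mulVec_eq_iff hβ hz w 0).mp ?_)
    rw [← hsw]
    simpa using hs
  rw [hsw, h0]
  funext i
  rcases i with j | lj <;> simp [scaledVec]

/-- If `f` agrees near `y` with `Φ m_{β,X}` for a differentiable solution `(β, X)` of the linearized
stationarity equations, its derivative at `y` has the matrix `Γ M⁻¹ Γᵀ`. -/
theorem divergence_eq_trace (hlam : 0 < lam) {y : Euc n} {k : ℕ} {β : Fin k → ℝ}
    (hβ : ∀ j, β j ≠ 0) {A : Fin k → Ω}
    (hz : IsNondegenerate φ lam y (dualSol Ω φ lam y) (β, fun j => (A j : Euc d)))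
    {ψ : Euc n → (Fin k → ℝ) × (Fin k → Euc d)} (hψy : ψ y = (β, fun j => (A j : Euc d)))
    (hψ : DifferentiableAt ℝ ψ y)
    (hψ' : ∀ h, fderiv ℝ (stationarity φ) (y, (β, fun j => (A j : Euc d))) (h, fderiv ℝ ψ y h) = 0)
    {f : Euc n → Euc n} (hf : f =ᶠ[𝓝 y] fun y' => synthesis φ (ψ y')) :
    DifferentiableAt ℝ f y ∧ divergence f y =
      (Gam φ A * (curvatureMat Ω φ lam y β A)⁻¹ * (Gam φ A)ᵀ).trace := by
  have hsy : HasFDerivAt (synthesis (k := k) φ)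
      (fderiv ℝ (synthesis (k := k) φ) (β, fun j => (A j : Euc d))) (ψ y) := by
    rw [hψy]
    exact ((contDiffAt_synthesis hz.smooth).differentiableAt (by simp)).hasFDerivAt
  have hd := (hsy.comp y hψ.hasFDerivAt).congr_of_eventuallyEq hf
  refine ⟨hd.differentiableAt, ?_⟩
  have hdet := isUnit_det_curvatureMat hlam hβ hz
  have key : ∀ h : Euc n, fderiv ℝ f y h = WithLp.toLp 2
      ((Gam φ A * (curvatureMat Ω φ lam y β A)⁻¹ * (Gam φ A)ᵀ) *ᵥ (h : Fin n → ℝ)) := by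
    intro h
    have h1 := (curvatureMat_mulVec_eq_iff hβ hz (fderiv ℝ ψ y h) h).mpr (hψ' h)
    rw [← Matrix.mulVec_mulVec, ← Matrix.mulVec_mulVec, ← h1, Matrix.mulVec_mulVec _ _⁻¹,
      Matrix.nonsing_inv_mul _ hdet, Matrix.one_mulVec, Gam_mulVec_scaledVec, hd.fderiv,
      ContinuousLinearMap.comp_apply, fderiv_synthesis_apply hz.smooth]
  rw [divergence, Matrix.trace]
  refine Finset.sum_congr rfl fun i _ => ?_
  rw [key]
  simp

/-! ### Tracking the solution -/

/-- Linear independence of the vectors `φ(x_j)` is stable, and the coefficients of a combination of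
them depend continuously on the points and on the combination. -/
theorem eventually_coefficients_near {k : ℕ} {X₀ : Fin k → Euc d}
    (hφX : ∀ j, ContinuousAt φ (X₀ j)) (hind : ∀ b : Fin k → ℝ, ∑ j, b j • φ (X₀ j) = 0 → b = 0)
    (β : Fin k → ℝ) {ε : ℝ} (hε : 0 < ε) :
    ∀ᶠ u : (Fin k → Euc d) × Euc n in 𝓝 (X₀, ∑ j, β j • φ (X₀ j)),
      (∀ b : Fin k → ℝ, ∑ j, b j • φ (u.1 j) = 0 → b = 0) ∧
      ∀ b : Fin k → ℝ, u.2 = ∑ j, b j • φ (u.1 j) → ‖b - β‖ < ε := by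
  let T : (Fin k → ℝ) →ₗ[ℝ] Euc n := Fintype.linearCombination ℝ fun j => φ (X₀ j)
  have hT : ∀ b : Fin k → ℝ, T b = ∑ j, b j • φ (X₀ j) := fun b =>
    Fintype.linearCombination_apply ℝ _ b
  have hker : T.ker = ⊥ := LinearMap.ker_eq_bot'.mpr fun b hb => hind b (by rw [← hT, hb])
  obtain ⟨c, hc, hanti⟩ := T.exists_antilipschitzWith hker
  have hbound : ∀ b : Fin k → ℝ, ‖b‖ ≤ c * ‖∑ j, b j • φ (X₀ j)‖ := fun b => by
    have := hanti.le_mul_dist b 0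
    rwa [map_zero, dist_zero_right, dist_zero_right, hT] at this
  have hc' : (0 : ℝ) < c := hc
  let g : (Fin k → Euc d) × Euc n → ℝ := fun u => ∑ j, ‖φ (u.1 j) - φ (X₀ j)‖
  have hg : ContinuousAt g (X₀, ∑ j, β j • φ (X₀ j)) := by
    refine tendsto_finsetSum _ fun j _ => ?_
    have h1 : ContinuousAt (fun u : (Fin k → Euc d) × Euc n => φ (u.1 j))
        (X₀, ∑ j, β j • φ (X₀ j)) :=
      ContinuousAt.comp (g := φ) (f := fun u : (Fin k → Euc d) × Euc n => u.1 j) (hφX j)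
        (by fun_prop)
    exact (h1.sub continuousAt_const).norm
  have hg0 : g (X₀, ∑ j, β j • φ (X₀ j)) = 0 := by simp [g]
  have hdiff : ∀ (u : (Fin k → Euc d) × Euc n) (b : Fin k → ℝ),
      ‖∑ j, b j • φ (u.1 j) - ∑ j, b j • φ (X₀ j)‖ ≤ ‖b‖ * g u := fun u b => by
    rw [← Finset.sum_sub_distrib, Finset.mul_sum]
    refine (norm_sum_le _ _).trans (Finset.sum_le_sum fun j _ => ?_)
    rw [← smul_sub, norm_smul]
    gcongr
    exact norm_le_pi_norm b j
  have h1 : ∀ᶠ u in 𝓝 (X₀, ∑ j, β j • φ (X₀ j)), g u < 1 / (2 * c) :=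
    hg.eventually_lt_const (by rw [hg0]; positivity)
  have h2 : ∀ᶠ u : (Fin k → Euc d) × Euc n in 𝓝 (X₀, ∑ j, β j • φ (X₀ j)),
      2 * c * (‖u.2 - ∑ j, β j • φ (X₀ j)‖ + ‖β‖ * g u) < ε := by
    have : ContinuousAt (fun u : (Fin k → Euc d) × Euc n =>
        2 * c * (‖u.2 - ∑ j, β j • φ (X₀ j)‖ + ‖β‖ * g u)) (X₀, ∑ j, β j • φ (X₀ j)) :=
      continuousAt_const.mul ((continuousAt_snd.sub continuousAt_const).norm.add
        (continuousAt_const.mul hg))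
    exact this.eventually_lt_const (by simpa [hg0] using hε)
  filter_upwards [h1, h2] with u hu1 hu2
  have hbound' : ∀ b : Fin k → ℝ, ‖b‖ ≤ 2 * c * ‖∑ j, b j • φ (u.1 j)‖ := fun b => by
    have h3 := hbound b
    have h4 := hdiff u b
    have h5 : ‖∑ j, b j • φ (X₀ j)‖ ≤ ‖∑ j, b j • φ (u.1 j)‖ +
        ‖∑ j, b j • φ (u.1 j) - ∑ j, b j • φ (X₀ j)‖ := by
      have := norm_sub_le (∑ j, b j • φ (u.1 j))
        (∑ j, b j • φ (u.1 j) - ∑ j, b j • φ (X₀ j))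
      rwa [sub_sub_cancel] at this
    have h6 : ‖b‖ * g u ≤ ‖b‖ * (1 / (2 * c)) := by gcongr
    have h7 : c * (‖b‖ * (1 / (2 * c))) = ‖b‖ / 2 := by field_simp
    have h8 : c * ‖∑ j, b j • φ (X₀ j)‖ ≤
        c * (‖∑ j, b j • φ (u.1 j)‖ + ‖b‖ * (1 / (2 * c))) := by gcongr; linarith
    rw [mul_add, h7] at h8
    linarith
  refine ⟨fun b hb => ?_, fun b hb => ?_⟩
  · have := hbound' b
    rw [hb, norm_zero, mul_zero] at this
    exact norm_le_zero_iff.mp this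
  · refine (hbound' (b - β)).trans_lt (lt_of_le_of_lt ?_ hu2)
    gcongr
    have h3 : ∑ j, (b - β) j • φ (u.1 j) = (u.2 - ∑ j, β j • φ (X₀ j)) -
        (∑ j, β j • φ (u.1 j) - ∑ j, β j • φ (X₀ j)) := by
      rw [hb]
      simp only [Pi.sub_apply, sub_smul, Finset.sum_sub_distrib]
      abel
    rw [h3]
    exact (norm_sub_le _ _).trans (by gcongr; exact hdiff u β)

/-- Independent columns, as many as the rank, span the column space. -/
theorem exists_mulVec_submatrix_eq {K k : ℕ} (M : Matrix (Fin n) (Fin K) ℝ) (f : Fin k → Fin K)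
    (hrank : M.rank = k) (hinj : Function.Injective (M.submatrix id f).mulVec) (c : Fin K → ℝ) :
    ∃ b, M *ᵥ c = M.submatrix id f *ᵥ b := by
  rw [Matrix.mulVec_injective_iff] at hinj
  have hle : (M.submatrix id f).mulVecLin.range ≤ M.mulVecLin.range := by
    rw [Matrix.range_mulVecLin, Matrix.range_mulVecLin]
    refine Submodule.span_mono ?_
    rintro _ ⟨j, rfl⟩
    exact ⟨f j, rfl⟩
  have heq := Submodule.eq_of_le_of_finrank_eq hle (by
    rw [Matrix.range_mulVecLin, finrank_span_eq_card hinj, Fintype.card_fin]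
    exact hrank.symm)
  have : M *ᵥ c ∈ M.mulVecLin.range := ⟨c, rfl⟩
  rw [← heq] at this
  obtain ⟨b, hb⟩ := this
  exact ⟨b, hb.symm⟩

theorem mulVec_PhiMat_injective_iff {k : ℕ} (X : Fin k → Ω) :
    Function.Injective (PhiMat φ X).mulVec ↔
      ∀ b : Fin k → ℝ, ∑ j, b j • φ (X j) = 0 → b = 0 := by
  have h0 : ∀ b : Fin k → ℝ, PhiMat φ X *ᵥ b = 0 ↔ ∑ j, b j • φ (X j) = 0 := fun b => by
    rw [← toLp_PhiMat_mulVec, WithLp.toLp_eq_zero]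
  constructor
  · intro h b hb
    exact h (((h0 b).mpr hb).trans (Matrix.mulVec_zero _).symm)
  · intro h
    exact (injective_iff_map_eq_zero (PhiMat φ X).mulVecLin).mpr fun b hb => h b ((h0 b).mp hb)

theorem IsInjectiveSolution.isNondegenerate (hφ : ContinuousOn φ Ω)
    (hφ0 : Tendsto (fun x : Ω => φ x) (cocompact Ω) (𝓝 0)) (hlam : 0 < lam) {y : Euc n}
    (hreg : ∀ x ∈ extSupport Ω φ lam y, x ∈ interior Ω ∧ ContDiffAt ℝ 2 φ x)
    (hA1 : AssumptionA1 Ω φ lam y) {k : ℕ} {β : Fin k → ℝ} {A : Fin k → Ω}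
    (h : IsInjectiveSolution Ω φ lam y β A) :
    IsNondegenerate φ lam y (dualSol Ω φ lam y) (β, fun j => (A j : Euc d)) := by
  obtain ⟨hres, hsign⟩ := h.residual_and_sign hφ hφ0 hlam hA1.1
  refine ⟨fun j => (hreg _ (h.2.1 j)).2, ?_, fun j v => ?_, fun j v hv => ?_,
    (mulVec_PhiMat_injective_iff A).mp h.2.2.1⟩
  · rw [synthesis, ← hres, sub_sub_cancel]
  · exact inner_fderiv_eq_zero (dualSol_feasible Ω φ lam y) (hreg _ (h.2.1 j)).1
      ((hreg _ (h.2.1 j)).2.differentiableAt (by simp)) (h.2.1 j).2 v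
  · have h1 := inner_fderiv_fderiv_neg (hreg _ (h.2.1 j)).2 (hA1.2 _ (h.2.1 j)) hv
    have h2 := mul_neg_of_pos_of_neg (hsign j) h1
    have h3 := certificate_mul_self (h.2.1 j)
    calc _ = β j * (certificate Ω φ lam y (A j) * certificate Ω φ lam y (A j)) *
          inner ℝ (fderiv ℝ (fderiv ℝ φ) (A j) v v) (dualSol Ω φ lam y) := by rw [h3, mul_one]
      _ = β j * certificate Ω φ lam y (A j) * (PhiAdj φ (dualSol Ω φ lam y) (A j) *
          inner ℝ (fderiv ℝ (fderiv ℝ φ) (A j) v v) (dualSol Ω φ lam y)) := by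
          rw [certificate]; ring
      _ < 0 := h2

/-- For `y'` near `y`, the solution of the stationarity equations consists of points of the extended
support of `y'` and represents `y' - λ p_{y'}`. -/
theorem eventually_tracking (hφ : ContinuousOn φ Ω)
    (hφ0 : Tendsto (fun x : Ω => φ x) (cocompact Ω) (𝓝 0)) (hlam : 0 < lam) {y : Euc n}
    (hreg : ∀ x ∈ extSupport Ω φ lam y, x ∈ interior Ω ∧ ContDiffAt ℝ 2 φ x)
    (hA1 : AssumptionA1 Ω φ lam y) (hy : y ∉ exceptionalSet Ω φ lam) {k : ℕ} {β : Fin k → ℝ}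
    {A : Fin k → Ω} (h : IsInjectiveSolution Ω φ lam y β A)
    {ψ : Euc n → (Fin k → ℝ) × (Fin k → Euc d)}
    (hψ : ∀ᶠ u in 𝓝 (y, (β, fun j => (A j : Euc d))),
      stationarity φ u = stationarity φ (y, (β, fun j => (A j : Euc d))) → ψ u.1 = u.2) :
    ∀ᶠ y' in 𝓝 y, (extSupport Ω φ lam y').Finite ∧
      y' - lam • dualSol Ω φ lam y' = synthesis φ (ψ y') ∧
      Function.Injective (ψ y').2 ∧
      ∀ j, (ψ y').2 j ∈ extSupport Ω φ lam y' ∧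
        certificate Ω φ lam y' ((ψ y').2 j) = certificate Ω φ lam y (A j) := by
  obtain ⟨hres, hsign⟩ := h.residual_and_sign hφ hφ0 hlam hA1.1
  have hnd := h.isNondegenerate hφ hφ0 hlam hreg hA1
  obtain ⟨C, hC, hctrl⟩ := exists_uniform_control hreg hA1
  -- an enumeration of the extended support at `y`
  let e := hA1.1.toFinset.equivFin.symm
  have hemem : ∀ j, (e j : Euc d) ∈ extSupport Ω φ lam y := fun j =>
    hA1.1.mem_toFinset.mp (e j).2
  let E : Fin hA1.1.toFinset.card → Ω := fun j => ⟨e j, (hemem j).1⟩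
  have hE : Function.Injective E := fun i j hij =>
    e.injective (Subtype.ext (congrArg (Subtype.val : Ω → Euc d) hij))
  have hEcov : ∀ x ∈ extSupport Ω φ lam y, ∃ j, (E j : Euc d) = x := fun x hx =>
    ⟨e.symm ⟨x, hA1.1.mem_toFinset.mpr hx⟩, by simp [E]⟩
  choose ι hιA using fun j => hEcov _ (h.2.1 j)
  have hAι : A = E ∘ ι := funext fun j => Subtype.ext (hιA j).symm
  have hι : Function.Injective ι := fun i j hij => h.1 (by
    rw [hAι, Function.comp_apply, Function.comp_apply, hij])
  have hcard := eventually_extSupport_card hφ hφ0 hlam hy hC hctrl hE hemem hEcov hι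
    (hAι ▸ h.2.2.1) (β := β) (by simpa only [hιA] using hres) (by simpa only [hιA] using hsign)
  obtain ⟨ε₁, hε₁, hψ⟩ := Metric.eventually_nhds_iff.mp hψ
  obtain ⟨ε₂, hε₂, hcoef⟩ := Metric.eventually_nhds_iff.mp (eventually_coefficients_near
    (fun j => (hnd.smooth j).continuousAt) hnd.indep β hε₁)
  -- with `y'` and `p_{y'}` within `r` of `y` and `p_y`, the points move by less than `C r`, and
  -- `y' - λ p_{y'}` moves by less than `(λ + 1) r`
  set r := min C⁻¹ (min ε₁ ε₂ / (C + lam + 1)) with hr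
  have hε₁₂ : 0 < min ε₁ ε₂ := lt_min hε₁ hε₂
  have hrpos : 0 < r := lt_min (inv_pos.mpr hC) (by positivity)
  have hrC : r ≤ C⁻¹ := min_le_left _ _
  have hrε : (C + lam + 1) * r ≤ min ε₁ ε₂ := by
    have h1 : r ≤ min ε₁ ε₂ / (C + lam + 1) := min_le_right _ _
    rw [le_div_iff₀ (by positivity)] at h1
    linarith
  filter_upwards [hcard, eventually_extSupport_near hφ hφ0 hlam y hrpos,
    eventually_extSupport_finite hφ hφ0 hlam hA1.1 hC hctrl, Metric.ball_mem_nhds y hrpos]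
    with y' hE' hnear hfin' hyy'
  obtain ⟨E', hE'inj, hE'mem, hrank⟩ := hE'
  obtain ⟨hq, hnear⟩ := hnear
  rw [Metric.mem_ball, dist_eq_norm] at hyy'
  have hqC := hq.trans_le hrC
  have hnearC : ∀ x' ∈ extSupport Ω φ lam y', ∃ x ∈ extSupport Ω φ lam y, ‖x' - x‖ < C⁻¹ :=
    fun x' hx' => (hnear x' hx').imp fun x hx => ⟨hx.1, hx.2.trans_le hrC⟩
  obtain ⟨π, hπ⟩ := exists_matching hC hctrl hqC hnearC hemem hEcov hE'inj hE'mem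
  have hE'cov : ∀ x' ∈ extSupport Ω φ lam y', ∃ j, (E' j : Euc d) = x' := fun x' hx' => by
    obtain ⟨x, hx, hxx⟩ := hnearC x' hx'
    obtain ⟨l, rfl⟩ := hEcov x hx
    exact ⟨π l, (hctrl _ hx).extSupport_unique hqC (hE'mem _) hx' (hπ l).1 hxx⟩
  set X : Fin k → Euc d := fun j => (E' (π (ι j)) : Euc d) with hX
  have hXA : ∀ j, ‖X j - A j‖ < C⁻¹ ∧
      ‖X j - A j‖ ≤ C * ‖dualSol Ω φ lam y' - dualSol Ω φ lam y‖ := fun j => by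
    rw [← hιA j]; exact hπ (ι j)
  have hXmem : ∀ j, X j ∈ extSupport Ω φ lam y' := fun j => hE'mem _
  have hXinj : Function.Injective X := fun i j hij =>
    hι (π.injective (hE'inj (Subtype.ext hij)))
  have hXdist : dist X (fun j => (A j : Euc d)) < min ε₁ ε₂ := by
    rw [dist_pi_lt_iff hε₁₂]
    intro j
    rw [dist_eq_norm]
    refine (hXA j).2.trans_lt (lt_of_lt_of_le ?_ hrε)
    have h1 := mul_lt_mul_of_pos_left hq hC
    have h2 : 0 < (lam + 1) * r := by positivity
    linarith
  have hwdist : dist (y' - lam • dualSol Ω φ lam y') (∑ j, β j • φ (A j)) < min ε₁ ε₂ := by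
    rw [dist_eq_norm, ← hres]
    have h1 : y' - lam • dualSol Ω φ lam y' - (y - lam • dualSol Ω φ lam y) =
        (y' - y) - lam • (dualSol Ω φ lam y' - dualSol Ω φ lam y) := by
      rw [smul_sub]; abel
    rw [h1]
    refine (norm_sub_le _ _).trans_lt (lt_of_lt_of_le ?_ hrε)
    rw [norm_smul, Real.norm_of_nonneg hlam.le]
    have h2 := mul_lt_mul_of_pos_left hq hlam
    have h3 : 0 < C * r := by positivity
    linarith
  obtain ⟨hXind, hXcoef⟩ := hcoef (y := (X, y' - lam • dualSol Ω φ lam y')) (by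
    rw [Prod.dist_eq, max_lt_iff]
    exact ⟨hXdist.trans_le (min_le_right _ _), hwdist.trans_le (min_le_right _ _)⟩)
  -- `y' - λ p_{y'}` is a combination of the values of `φ` on the extended support of `y'`, hence,
  -- the rank being `k`, of its values at the points `X j`
  obtain ⟨b, hb⟩ : ∃ b : Fin k → ℝ, y' - lam • dualSol Ω φ lam y' = ∑ j, b j • φ (X j) := by
    obtain ⟨k', β', X', hsol', hres', -⟩ := exists_isInjectiveSolution hφ hφ0 hlam y' hfin'
    have hspan : y' - lam • dualSol Ω φ lam y' ∈
        Submodule.span ℝ (range fun j => φ (E' j)) := by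
      rw [hres']
      refine Submodule.sum_mem _ fun j _ => Submodule.smul_mem _ _ (Submodule.subset_span ?_)
      obtain ⟨l, hl⟩ := hE'cov _ (hsol'.2.1 j)
      exact ⟨l, by rw [← hl]⟩
    obtain ⟨c, hc⟩ := (Submodule.mem_span_range_iff_exists_fun ℝ).mp hspan
    have hinj : Function.Injective ((PhiMat φ E').submatrix id (π ∘ ι)).mulVec :=
      (mulVec_PhiMat_injective_iff (φ := φ) (E' ∘ (π ∘ ι))).mpr hXind
    obtain ⟨b, hb⟩ := exists_mulVec_submatrix_eq (PhiMat φ E') (π ∘ ι) hrank hinj c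
    refine ⟨b, ?_⟩
    rw [← hc, ← toLp_PhiMat_mulVec, hb]
    exact toLp_PhiMat_mulVec φ (E' ∘ (π ∘ ι)) b
  have hbβ : dist b β < ε₁ := by rw [dist_eq_norm]; exact hXcoef b hb
  have hcert : ∀ j, certificate Ω φ lam y' (X j) = certificate Ω φ lam y (A j) := fun j => by
    have h1 : 0 < certificate Ω φ lam y (A j) * certificate Ω φ lam y' (X j) :=
      (hctrl _ (h.2.1 j)).sign _ hqC _ (hXA j).1
    have h2 : certificate Ω φ lam y (A j) * certificate Ω φ lam y' (X j) = 1 := by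
      rw [← abs_of_pos h1, abs_mul, (h.2.1 j).2, (hXmem j).2, one_mul]
    have h3 := certificate_mul_self (h.2.1 j)
    linear_combination certificate Ω φ lam y (A j) * h2 - certificate Ω φ lam y' (X j) * h3
  have hψy' : ψ y' = (b, X) := by
    refine hψ (y := (y', (b, X))) ?_ ?_
    · rw [Prod.dist_eq, max_lt_iff, Prod.dist_eq, max_lt_iff]
      refine ⟨?_, hbβ, hXdist.trans_le (min_le_left _ _)⟩
      rw [dist_eq_norm]
      refine hyy'.trans_le (le_trans ?_ (hrε.trans (min_le_left _ _)))
      have h3 : 0 < (C + lam) * r := by positivity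
      linarith
    · have hr1 : y' - synthesis φ (b, X) = lam • dualSol Ω φ lam y' := by
        rw [synthesis, ← hb, sub_sub_cancel]
      have hr2 := hnd.residual
      refine Prod.ext (funext fun j => ?_) (funext fun j => ContinuousLinearMap.ext fun v => ?_)
      · simp only [stationarity, hr1, hr2, real_inner_smul_right]
        exact congrArg (lam * ·) (hcert j)
      · simp only [stationarity, hr1, hr2, ContinuousLinearMap.comp_apply, innerSL_apply_apply,
          real_inner_smul_left]
        rw [real_inner_comm, (hctrl _ (h.2.1 j)).inner_fderiv_eq_zero (hXmem j) (hXA j).1,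
          real_inner_comm, hnd.crit j]
  rw [hψy']
  exact ⟨hfin', hb, hXinj, fun j => ⟨hXmem j, hcert j⟩⟩

end Blasso

end

theorem mainTheorem1 {d n : ℕ} (Ω : Set (Blasso.Euc d)) (hΩ : MeasurableSet Ω)
    (φ : Blasso.Euc d → Blasso.Euc n) (hφ : ContinuousOn φ Ω)
    (hφ0 : Tendsto (fun x : Ω => φ x) (cocompact Ω) (𝓝 0))
    (lam : ℝ) (hlam : 0 < lam) (y : Blasso.Euc n)
    (hreg : ∀ x ∈ Blasso.extSupport Ω φ lam y, x ∈ interior Ω ∧ ContDiffAt ℝ 2 φ x)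
    (hA1 : Blasso.AssumptionA1 Ω φ lam y)
    (hy : y ∉ Blasso.exceptionalSet Ω φ lam) :
    (∃ (k : ℕ) (β₀ : Fin k → ℝ) (A₀ : Fin k → Ω), Blasso.IsInjectiveSolution Ω φ lam y β₀ A₀) ∧
    ∀ (k : ℕ) (β₀ : Fin k → ℝ) (A₀ : Fin k → Ω), Blasso.IsInjectiveSolution Ω φ lam y β₀ A₀ →
      (∃ (U : Set (Blasso.Euc n)) (β : Blasso.Euc n → Fin k → ℝ) (A : Blasso.Euc n → Fin k → Ω),
        IsOpen U ∧ y ∈ U ∧ β y = β₀ ∧ A y = A₀ ∧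
        (∀ y' ∈ U, (∀ j, β y' j ≠ 0) ∧ Function.Injective (A y') ∧
          Blasso.IsSolution Ω φ lam y' (Blasso.discreteMeasure (β y') (A y'))) ∧
        ContDiffOn ℝ 1 (fun y' => (β y', fun j => (A y' j : Blasso.Euc d))) U) ∧
      IsUnit (Blasso.curvatureMat Ω φ lam y β₀ A₀).det ∧
      DifferentiableAt ℝ (Blasso.muHat Ω φ lam) y ∧
      Blasso.divergence (Blasso.muHat Ω φ lam) y =
        (Blasso.Gam φ A₀ * (Blasso.curvatureMat Ω φ lam y β₀ A₀)⁻¹ * (Blasso.Gam φ A₀)ᵀ).trace := by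
  classical
  refine ⟨?_, fun k β₀ A₀ h => ?_⟩
  · obtain ⟨k, β, X, hX, -⟩ := Blasso.exists_isInjectiveSolution hφ hφ0 hlam y hA1.1
    exact ⟨k, β, X, hX⟩
  have hsign := (h.residual_and_sign hφ hφ0 hlam hA1.1).2
  have hnd := h.isNondegenerate hφ hφ0 hlam hreg hA1
  obtain ⟨ψ, hψy, hψc, hψ', hψu⟩ := hnd.exists_implicit hlam
  have htrack := Blasso.eventually_tracking hφ hφ0 hlam hreg hA1 hy h hψu
  have hpos : ∀ᶠ y' in 𝓝 y, ∀ j, 0 < (ψ y').1 j * Blasso.certificate Ω φ lam y (A₀ j) := by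
    refine eventually_all.mpr fun j => ?_
    have hc : ContinuousAt (fun y' => (ψ y').1 j * Blasso.certificate Ω φ lam y (A₀ j)) y := by
      have h1 : ContinuousAt (fun y' => (ψ y').1) y := hψc.continuousAt.fst
      exact ((continuousAt_pi.mp h1) j).mul continuousAt_const
    refine hc.eventually_const_lt ?_
    simp only [hψy]
    exact hsign j
  refine ⟨?_, Blasso.isUnit_det_curvatureMat hlam h.2.2.2.1 hnd,
    Blasso.divergence_eq_trace hlam h.2.2.2.1 hnd hψy (hψc.differentiableAt (by simp)) hψ' ?_⟩
  · obtain ⟨U, hU, hUo, hyU⟩ := mem_nhds_iff.mp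
      ((htrack.and hpos).and (hψc.eventually (by simp)))
    refine ⟨U, fun y' => (ψ y').1, fun y' => if hy' : ∀ j, (ψ y').2 j ∈ Ω then
      fun j => ⟨(ψ y').2 j, hy' j⟩ else A₀, hUo, hyU, by simp only [hψy], ?_, ?_, ?_⟩
    · have hmem : ∀ j, (ψ y).2 j ∈ Ω := fun j => by rw [hψy]; exact (A₀ j).2
      simp only
      rw [dif_pos hmem]
      funext j
      exact Subtype.ext (by simp only [hψy])
    · intro y' hy'
      obtain ⟨⟨⟨-, hres, hinj, hmem⟩, hpos⟩, -⟩ := hU hy'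
      have hmemΩ : ∀ j, (ψ y').2 j ∈ Ω := fun j => (hmem j).1.1
      simp only
      rw [dif_pos hmemΩ]
      refine ⟨fun j hj => ?_, fun i j hij => hinj (congrArg Subtype.val hij), ?_⟩
      · have := hpos j
        rw [hj, zero_mul] at this
        exact lt_irrefl _ this
      · refine Blasso.isSolution_of_certificate hφ hφ0 hlam ?_ (Blasso.dualSol_feasible Ω φ lam y')
          ((Blasso.tvNorm_discreteMeasure_le _ _).trans ?_)
        · rw [Blasso.Phi_discreteMeasure]; exact hres
        · rw [Blasso.Phi_discreteMeasure, sum_inner]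
          refine Finset.sum_le_sum fun j _ => ?_
          have h1 : inner ℝ (φ ((ψ y').2 j)) (Blasso.dualSol Ω φ lam y') =
              Blasso.certificate Ω φ lam y (A₀ j) := (hmem j).2
          rw [real_inner_smul_left, h1, ← abs_of_pos (hpos j), abs_mul, (h.2.1 j).2, mul_one]
    · intro y' hy'
      refine (hU hy').2.contDiffWithinAt.congr_of_mem (fun z hz => ?_) hy'
      have hmemΩ : ∀ j, (ψ z).2 j ∈ Ω := fun j => ((hU hz).1.1.2.2.2 j).1.1
      simp only [dif_pos hmemΩ]
  · filter_upwards [htrack] with y' hy'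
    rw [Blasso.muHat_eq_residual hφ hφ0 hlam hy'.1, hy'.2.1]
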